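/- Let $k\ge 1$ be an integer and $\theta = 2\pi/(4k+2)$. Let $P$ be a finite set of points in the plane (the vertices), and let $S$ be a planar set of constraints: line segments between two vertices of $P$, no two of which intersect properly. Two vertices $u,v$ can see each other if $uv$ does not properly intersect any constraint or $uv$ is itself a constraint. For each vertex $u$, the $4k+2$ rays from $u$ at consecutive angle $\theta$ bound the cones $C_0^u,\dots,C_{4k+1}^u$, numbered clockwise, the bisector of $C_0^u$ pointing vertically upward. Assume general position: no two points of $P$ lie on a line parallel to one of the rays that define the cones, no two lie on a line perpendicular to the bisector of a cone, and no three are collinear. The constraints with endpoint $u$ whose other endpoint lies in $C_i^u$ split $C_i^u$ into subcones; the other endpoint of such a constraint belongs to both adjacent subcones. The constrained $\theta$-graph with $4k+2$ cones has vertex set $P$ and, for every vertex $u$ and every subcone of every cone $C_i^u$, an edge from $u$ to the vertex closest to $u$ among the vertices $v \neq u$ in that subcone that can see $u$ (if there is one), where the distance is the length of the projection of $uv$ on the bisector of $C_i^u$. Theorem. Let $u\neq w$ be two vertices that can see each other, and let $C_i^u$ be the cone of $u$ that contains $w$. Let the canonical triangle of $u$ and $w$ be the triangle bounded by the two borders of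 $C_i^u$ and the line through $w$ perpendicular to the bisector of $C_i^u$, let $m$ be the midpoint of its side opposite $u$, and let $\alpha$ be the unsigned angle between $uw$ and $um$. Then the constrained $\theta$-graph with $4k+2$ cones contains a path connecting $u$ and $w$ of total Euclidean length at most $$\left(\frac{1+\sin(\theta/2)}{\cos(\theta/2)}\cdot\cos\alpha+\sin\alpha\right)\cdot|uw|.$$ -/

import Mathlib

open scoped RealInnerProductSpace

noncomputable section

namespace ConstrainedTheta

/-- The Euclidean plane. -/
abbrev Plane : Type := EuclideanSpace ℝ (Fin 2)

/-- The unit vector at angle `φ` (counterclockwise from the positive horizontal axis). -/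
def unitVec (φ : ℝ) : Plane := !₂[Real.cos φ, Real.sin φ]

/-- The aperture `θ = 2π / m` of the cones. -/
def aperture (m : ℕ) : ℝ := 2 * Real.pi / m

/-- Direction of the bisector of the `i`-th cone. Cone `0` has the upward vertical bisector and
the cones are numbered clockwise. -/
def bisectorDir (m i : ℕ) : Plane := unitVec (Real.pi / 2 - i * aperture m)

/-- Directions of the cone rays: `rayDir m i` and `rayDir m (i + 1)` are the left
(counterclockwise) and the right (clockwise) border of the `i`-th cone. -/
def rayDir (m i : ℕ) : Plane := unitVec (Real.pi / 2 + aperture m / 2 - i * aperture m)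

/-- The closed convex region between the rays from the apex `u` in the directions `r` and `s`. -/
def sector (u r s : Plane) : Set Plane :=
  {x | ∃ a b : ℝ, 0 ≤ a ∧ 0 ≤ b ∧ x = u + a • r + b • s}

/-- The cone `C_i^u` (with its apex). -/
def cone (m i : ℕ) (u : Plane) : Set Plane := sector u (rayDir m i) (rayDir m (i + 1))

/-- The planar cross product; it is positive iff `y` is reached from `x` by a counterclockwise
rotation by an angle in `(0, π)` (and `x, y ≠ 0`). -/
def cross (x y : Plane) : ℝ := x 0 * y 1 - x 1 * y 0

/-- Two segments intersect properly: they cross in a single point, interior to both. -/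
def ProperlyIntersect (a b c d : Plane) : Prop :=
  ∃ p, openSegment ℝ a b ∩ openSegment ℝ c d = {p}

/-- A set of constraints, that is, of segments between two vertices of `P`, is given as a simple
graph `S` on `P`. It is planar if no two constraints intersect properly. -/
def PlanarConstraints {P : Finset Plane} (S : SimpleGraph P) : Prop :=
  ∀ a b c d : P, S.Adj a b → S.Adj c d → ¬ ProperlyIntersect (a : Plane) b c d

/-- `u` and `v` can see each other. -/
def CanSee {P : Finset Plane} (S : SimpleGraph P) (u v : P) : Prop :=
  (∀ a b : P, S.Adj a b → ¬ ProperlyIntersect (u : Plane) v a b) ∨ S.Adj u v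

/-- General position with respect to the `m` cones: no two points on a line parallel to a cone ray,
no two points on a line perpendicular to a cone bisector, no three points collinear. -/
structure GeneralPosition (m : ℕ) (P : Finset Plane) : Prop where
  not_parallel : ∀ p ∈ P, ∀ q ∈ P, p ≠ q → ∀ i < m, ∀ t : ℝ, q - p ≠ t • rayDir m i
  not_perpendicular : ∀ p ∈ P, ∀ q ∈ P, p ≠ q → ∀ i < m, ⟪q - p, bisectorDir m i⟫ ≠ 0
  not_collinear : ∀ p ∈ P, ∀ q ∈ P, ∀ r ∈ P, p ≠ q → p ≠ r → q ≠ r →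
    ¬ Collinear ℝ ({p, q, r} : Set Plane)

/-- The directions of the rays from `u` that bound the subcones of `C_i^u`: the two borders of the
cone, and the directions of the constraints at `u` whose other endpoint lies in the cone. -/
def splitDirs {P : Finset Plane} (S : SimpleGraph P) (m : ℕ) (u : P) (i : ℕ) : Set Plane :=
  {rayDir m i, rayDir m (i + 1)} ∪
    {d | ∃ v : P, S.Adj u v ∧ (v : Plane) ∈ cone m i u ∧ d = (v : Plane) - u}

/-- `T` is one of the subcones of `C_i^u`: the closed region between a splitting ray (direction
`r`) and the next one in clockwise order (direction `s`). A vertex whose constraint to `u` splits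
the cone therefore lies in both adjacent subcones. -/
def IsSubcone {P : Finset Plane} (S : SimpleGraph P) (m : ℕ) (u : P) (i : ℕ)
    (T : Set Plane) : Prop :=
  ∃ r ∈ splitDirs S m u i, ∃ s ∈ splitDirs S m u i,
    0 < cross s r ∧
    (∀ d ∈ splitDirs S m u i, ¬ (0 < cross s d ∧ 0 < cross d r)) ∧
    T = sector u r s

/-- The orthogonal projection of `v` on the line through `u` containing the bisector of
`C_i^u`. -/
def bisectorProj (m i : ℕ) (u v : Plane) : Plane :=
  u + ⟪v - u, bisectorDir m i⟫ • bisectorDir m i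

/-- In one of its subcones, `u` adds an edge to `v`: `v` can see `u` and is closest to `u` among
the vertices of the subcone that can see `u`, measured along the bisector of the cone. -/
def AddsEdge {P : Finset Plane} (S : SimpleGraph P) (m : ℕ) (u v : P) : Prop :=
  u ≠ v ∧ CanSee S u v ∧
    ∃ i < m, ∃ T : Set Plane, IsSubcone S m u i T ∧ (v : Plane) ∈ T ∧
      ∀ w : P, w ≠ u → CanSee S u w → (w : Plane) ∈ T →
        dist (u : Plane) (bisectorProj m i u v) ≤ dist (u : Plane) (bisectorProj m i u w)

/-- The constrained theta-graph of `P` with constraints `S` and `m` cones. -/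
def constrainedThetaGraph {P : Finset Plane} (S : SimpleGraph P) (m : ℕ) : SimpleGraph P where
  Adj u v := AddsEdge S m u v ∨ AddsEdge S m v u
  symm := ⟨fun _ _ h => h.symm⟩
  loopless := ⟨fun _ h => h.elim (fun h => h.1 rfl) (fun h => h.1 rfl)⟩

/-- The total Euclidean length of the edges of a walk in a graph on points of the plane. -/
def walkLength {P : Finset Plane} {G : SimpleGraph P} {u w : P} (p : G.Walk u w) : ℝ :=
  (p.darts.map fun e => dist (e.fst : Plane) (e.snd : Plane)).sum

/-- The point where the line through `u` in direction `r` meets the line through `w` perpendicular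
to the bisector of `C_i^u`. -/
def corner (m i : ℕ) (u w r : Plane) : Plane :=
  u + (⟪w - u, bisectorDir m i⟫ / ⟪r, bisectorDir m i⟫) • r

/-- For `w` in `C_i^u`: the midpoint of the side opposite `u` of the canonical triangle of `u`
containing `w`, which is bounded by the borders of `C_i^u` and the line through `w` perpendicular
to the bisector. -/
def canonicalMidpoint (m i : ℕ) (u w : Plane) : Plane :=
  midpoint ℝ (corner m i u w (rayDir m i)) (corner m i u w (rayDir m (i + 1)))

end ConstrainedTheta

end

open scoped RealInnerProductSpace

noncomputable section

namespace ConstrainedTheta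

/-! The proof is an induction on the height of the canonical triangle, that is, the extent `Y` of
`uw` along the bisector; only finitely many heights occur. With `X` the coordinate across the
bisector and `s`, `c` the sine and cosine of `θ/2`, the claimed bound is `|X| + (1 + s)/c * Y`: the
longer of the two paths that follow one border of the triangle and then the side opposite `u` to
`w`. For the induction to close, `PairBound` carries a second bound: if no vertex lies in the
triangle to the right of `uw`, the path over the left border, of length `X + (1 + s)/c * Y`, is
already enough. Frames of both orientations are admitted, so the mirror image is included.

Let `v` be the vertex to which `u` adds an edge in a subcone of `w`. If `v ≠ w`, let `v` be to the
left of `uw`. The vertices in the wedge between `uv` and `uw` have a convex hull whose side facing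
`u` is a chain from `v` to `w`. Consecutive chain vertices see each other (`exists_next`): a
blocking constraint would have an endpoint between `u` and the chain, so it would cross `uv` or
`uw`, or start at `u` and split the subcone. As `v` is lowest, the chain ascends.

Each chain edge `pq` has a smaller canonical triangle in a suitable cone (`Link.reach`). An edge
leaning left lies in the corresponding cone of `p`. A steep edge leaning right lies in a rotated
cone whose bound is no worse (`Frame.exists_rot`). For a nearly horizontal edge the cone of `q`
containing `p` is used: with `4k + 2` cones, its border path is that of `p` reversed, and the second
bound applies since the triangle below the edge is empty (`lower_triangle`).

Signed border lengths are additive, so the bounds telescope along the chain. If `w` is not left of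
the bisector, or the right part is empty, the left border serves throughout
(`ChainState.reach_left`). Otherwise the chain leans right and then left, and changing from the left
border to the right one only helps, because the whole chain is left of the bisector
(`ChainState.reach_mixed`). -/

/-- The planar cross product, up to a sign `σ` that fixes the orientation. -/
def turn (σ : ℝ) (x y : Plane) : ℝ := σ * cross x y

/-! ### Oriented cross products and general position -/

theorem turn_add_left (σ : ℝ) (x y z : Plane) :
    turn σ (x + y) z = turn σ x z + turn σ y z := by
  simp only [turn, cross, PiLp.add_apply]; ring

theorem turn_add_right (σ : ℝ) (x y z : Plane) :
    turn σ x (y + z) = turn σ x y + turn σ x z := by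
  simp only [turn, cross, PiLp.add_apply]; ring

theorem turn_smul_left (σ t : ℝ) (x y : Plane) : turn σ (t • x) y = t * turn σ x y := by
  simp only [turn, cross, PiLp.smul_apply, smul_eq_mul]; ring

theorem turn_smul_right (σ t : ℝ) (x y : Plane) : turn σ x (t • y) = t * turn σ x y := by
  simp only [turn, cross, PiLp.smul_apply, smul_eq_mul]; ring

theorem turn_swap (σ : ℝ) (x y : Plane) : turn σ y x = - turn σ x y := by
  simp only [turn, cross]; ring

theorem turn_self (σ : ℝ) (x : Plane) : turn σ x x = 0 := by
  simp only [turn, cross]; ring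

theorem turn_smul_eq (σ : ℝ) (w p x : Plane) :
    turn σ w p • x = turn σ x p • w + turn σ w x • p := by
  ext i
  fin_cases i <;>
    simp [turn, cross, PiLp.add_apply, PiLp.smul_apply, smul_eq_mul] <;> ring

/-- Cramer's rule; it turns every statement about sides of lines into one about signs of
coefficients. -/
theorem eq_combination {σ : ℝ} {w p : Plane} (h : turn σ w p ≠ 0) (x : Plane) :
    x = (turn σ w x / turn σ w p) • p + (turn σ x p / turn σ w p) • w := by
  have := congrArg (fun y => (turn σ w p)⁻¹ • y) (turn_smul_eq σ w p x)
  simp only [smul_add, smul_smul, inv_mul_cancel₀ h, one_smul] at this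
  rw [div_eq_inv_mul, div_eq_inv_mul, add_comm]
  exact this

theorem collinear_of_turn_eq_zero {σ : ℝ} (hσ : σ ≠ 0) {p q r : Plane} (hpq : p ≠ q)
    (h : turn σ (q - p) (r - p) = 0) : Collinear ℝ ({p, q, r} : Set Plane) := by
  rw [collinear_iff_of_mem (p₀ := p) (by simp)]
  refine ⟨q - p, ?_⟩
  have hc : (q - p) 0 * (r - p) 1 - (q - p) 1 * (r - p) 0 = 0 := by
    simpa [turn, cross, hσ] using h
  have hr : ∃ t : ℝ, r - p = t • (q - p) := by
    by_cases h0 : (q - p) 0 = 0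
    · have h1 : (q - p) 1 ≠ 0 := by
        intro h1
        apply hpq
        symm
        rw [← sub_eq_zero]
        ext i
        fin_cases i
        · exact h0
        · exact h1
      refine ⟨(r - p) 1 / (q - p) 1, ?_⟩
      rw [h0] at hc
      have hr0 : (r - p) 0 = 0 := by
        have : (q - p) 1 * (r - p) 0 = 0 := by linarith
        exact (mul_eq_zero.mp this).resolve_left h1
      ext i
      fin_cases i
      · change (r - p) 0 = (r - p) 1 / (q - p) 1 * (q - p) 0
        rw [h0, hr0, mul_zero]
      · change (r - p) 1 = (r - p) 1 / (q - p) 1 * (q - p) 1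
        field_simp
    · refine ⟨(r - p) 0 / (q - p) 0, ?_⟩
      ext i
      fin_cases i
      · change (r - p) 0 = (r - p) 0 / (q - p) 0 * (q - p) 0
        field_simp
      · change (r - p) 1 = (r - p) 0 / (q - p) 0 * (q - p) 1
        field_simp
        linarith
  obtain ⟨t, ht⟩ := hr
  intro x hx
  simp only [Set.mem_insert_iff, Set.mem_singleton_iff] at hx
  rcases hx with rfl | rfl | rfl
  · exact ⟨0, by simp⟩
  · exact ⟨1, by simp⟩
  · exact ⟨t, by rw [← ht]; simp⟩

theorem GeneralPosition.turn_ne_zero {m : ℕ} {P : Finset Plane} (hP : GeneralPosition m P) {σ : ℝ}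
    (hσ : σ ≠ 0) {p q r : P} (hpq : p ≠ q) (hpr : p ≠ r) (hqr : q ≠ r) :
    turn σ ((q : Plane) - p) (r - p) ≠ 0 := fun h =>
  hP.not_collinear p p.2 q q.2 r r.2 (fun h => hpq (Subtype.ext h)) (fun h => hpr (Subtype.ext h))
    (fun h => hqr (Subtype.ext h))
    (collinear_of_turn_eq_zero hσ (fun h => hpq (Subtype.ext h)) h)

/-! ### Proper crossings and visibility -/

theorem mem_openSegment_iff_sub {a b x : Plane} :
    x ∈ openSegment ℝ a b ↔ ∃ t : ℝ, 0 < t ∧ t < 1 ∧ x - a = t • (b - a) := by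
  rw [openSegment_eq_image']
  constructor
  · rintro ⟨t, ht, rfl⟩
    exact ⟨t, ht.1, ht.2, by simp⟩
  · rintro ⟨t, h0, h1, h⟩
    exact ⟨t, ⟨h0, h1⟩, by simp only; rw [← h]; abel⟩

/-- As `a` is off the line `up`, the line `ab` meets it only once, so a common point is the only
one. -/
theorem properlyIntersect_of_mem {σ : ℝ} {u p a b g : Plane}
    (ha : turn σ (p - u) (a - u) ≠ 0) (hg : g ∈ openSegment ℝ u p)
    (hg' : g ∈ openSegment ℝ a b) : ProperlyIntersect u p a b := by
  refine ⟨g, Set.eq_singleton_iff_unique_mem.mpr ⟨⟨hg, hg'⟩, ?_⟩⟩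
  rintro x ⟨hx, hx'⟩
  obtain ⟨t, _, _, ht⟩ := mem_openSegment_iff_sub.mp hg
  obtain ⟨t', _, _, ht'⟩ := mem_openSegment_iff_sub.mp hx
  obtain ⟨s, hs0, _, hs⟩ := mem_openSegment_iff_sub.mp hg'
  obtain ⟨s', hs0', _, hs'⟩ := mem_openSegment_iff_sub.mp hx'
  have e1 : turn σ (p - u) (g - u) = 0 := by rw [ht, turn_smul_right, turn_self, mul_zero]
  have e2 : turn σ (p - u) (x - u) = 0 := by rw [ht', turn_smul_right, turn_self, mul_zero]
  have e3 : turn σ (p - u) (g - u) = turn σ (p - u) (a - u) + s * turn σ (p - u) (b - a) := by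
    rw [← turn_smul_right, ← hs, ← turn_add_right]; congr 1; abel
  have e4 : turn σ (p - u) (x - u) = turn σ (p - u) (a - u) + s' * turn σ (p - u) (b - a) := by
    rw [← turn_smul_right, ← hs', ← turn_add_right]; congr 1; abel
  have hne : turn σ (p - u) (b - a) ≠ 0 := fun h0 => ha (by rw [h0] at e3; linarith)
  have hss : s' = s := by
    apply mul_right_cancel₀ hne; linarith
  have : x - a = g - a := by rw [hs, hs', hss]
  exact sub_left_injective this

theorem CanSee.not_properlyIntersect {P : Finset Plane} {S : SimpleGraph P}
    (hS : PlanarConstraints S) {u v : P} (h : CanSee S u v) {a b : P} (hab : S.Adj a b) :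
    ¬ ProperlyIntersect (u : Plane) v a b :=
  h.elim (fun h => h a b hab) fun h => hS u v a b h hab

theorem ProperlyIntersect.swap_left {a b c d : Plane} (h : ProperlyIntersect a b c d) :
    ProperlyIntersect b a c d := by
  obtain ⟨p, hp⟩ := h
  exact ⟨p, by rwa [openSegment_symm ℝ b a]⟩

theorem CanSee.symm {P : Finset Plane} {S : SimpleGraph P} {u v : P} (h : CanSee S u v) :
    CanSee S v u :=
  h.imp (fun h a b hab hp => h a b hab hp.swap_left) (SimpleGraph.Adj.symm)

theorem not_properlyIntersect_self (a b : Plane) (hab : a ≠ b) : ¬ ProperlyIntersect a b a b := by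
  rintro ⟨p, hp⟩
  rw [Set.inter_self] at hp
  have hinf : (openSegment ℝ a b).Infinite := by
    rw [openSegment_eq_image']
    refine Set.Infinite.image ?_ (Set.Ioo_infinite zero_lt_one)
    intro s _ t _ hst
    have : (s - t) • (b - a) = 0 := by
      rw [sub_smul, sub_eq_zero]; exact add_left_cancel hst
    rcases smul_eq_zero.mp this with h | h
    · linarith
    · exact absurd (sub_eq_zero.mp h).symm hab
  rw [hp] at hinf
  exact hinf (Set.finite_singleton p)

/-- A segment that leaves the wedge with apex `u` and sides through `p` and `w` on the side of the
line `pq` that contains `u` crosses one of the segments `up` and `uw`. -/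
theorem exists_mem_openSegment_of_exit {σ : ℝ} {u p w q f a b : Plane}
    (hD : 0 < turn σ (w - u) (p - u)) (hfp : 0 < turn σ (f - u) (p - u))
    (hfw : 0 < turn σ (w - u) (f - u)) (hfl : turn σ (q - p) (f - p) ≤ 0)
    (hal : turn σ (q - p) (a - p) < 0) (hul : turn σ (q - p) (u - p) < 0)
    (hwl : 0 ≤ turn σ (q - p) (w - p))
    (ha : ¬ (0 ≤ turn σ (a - u) (p - u) ∧ 0 ≤ turn σ (w - u) (a - u)))
    (hf : f ∈ openSegment ℝ a b) (hcol : turn σ (f - u) (a - u) ≠ 0) :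
    (∃ g ∈ openSegment ℝ u p, g ∈ openSegment ℝ a b) ∨
      ∃ g ∈ openSegment ℝ u w, g ∈ openSegment ℝ a b := by
  set d := turn σ (w - u) (p - u) with hd
  have hfE := eq_combination hD.ne' (f - u)
  have haE := eq_combination hD.ne' (a - u)
  rw [← hd] at hfE haE
  set xf := turn σ (w - u) (f - u) / d with hxf
  set yf := turn σ (f - u) (p - u) / d with hyf
  set xa := turn σ (w - u) (a - u) / d with hxa
  set ya := turn σ (a - u) (p - u) / d with hya
  have hxf0 : 0 < xf := div_pos hfw hD
  have hyf0 : 0 < yf := div_pos hfp hD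
  have ha' : ¬ (0 ≤ ya ∧ 0 ≤ xa) := by
    rintro ⟨h1, h2⟩
    refine ha ⟨?_, ?_⟩
    · have := mul_nonneg h1 hD.le; rwa [hya, div_mul_cancel₀ _ hD.ne'] at this
    · have := mul_nonneg h2 hD.le; rwa [hxa, div_mul_cancel₀ _ hD.ne'] at this
  have hE : xa * yf - xf * ya ≠ 0 := by
    intro h0
    apply hcol
    rw [hfE, haE]
    simp only [turn_add_left, turn_add_right, turn_smul_left, turn_smul_right, turn_self,
      ← hd, turn_swap σ (w - u) (p - u)]
    linear_combination d * h0
  -- Moving from `f` towards `a` stays on the constraint and strictly on the side of `u`. The point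
  -- sought is where one coordinate in the basis `p - u`, `w - u` vanishes.
  have key : ∀ τ : ℝ, 0 < τ → τ < 1 →
      f + τ • (a - f) ∈ openSegment ℝ a b ∧ turn σ (q - p) (f + τ • (a - f) - p) < 0 ∧
      f + τ • (a - f) - u = (xf + τ * (xa - xf)) • (p - u) + (yf + τ * (ya - yf)) • (w - u) := by
    intro τ h0 h1
    refine ⟨?_, ?_, ?_⟩
    · rw [mem_openSegment_iff_sub] at hf ⊢
      obtain ⟨s, hs0, hs1, hs⟩ := hf
      refine ⟨s * (1 - τ), by nlinarith, by nlinarith, ?_⟩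
      rw [mul_comm, mul_smul, ← hs]
      module
    · have : f + τ • (a - f) - p = (1 - τ) • (f - p) + τ • (a - p) := by module
      rw [this, turn_add_right, turn_smul_right, turn_smul_right]
      nlinarith
    · have : f + τ • (a - f) - u = (1 - τ) • (f - u) + τ • (a - u) := by module
      rw [this, hfE, haE]
      module
  have hup : turn σ (q - p) (p - u) = - turn σ (q - p) (u - p) := by
    simp only [turn, cross, PiLp.sub_apply]; ring
  have hline : ∀ (g : Plane) (x y : ℝ), g - u = x • (p - u) + y • (w - u) →
      turn σ (q - p) (g - p) = turn σ (q - p) (u - p) * (1 - x - y) +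
        y * turn σ (q - p) (w - p) := by
    intro g x y hg
    have : g - p = (1 - x - y) • (u - p) + y • (w - p) := by
      have : g - p = (g - u) + (u - p) := by abel
      rw [this, hg]; module
    rw [this, turn_add_right, turn_smul_right, turn_smul_right]; ring
  -- The side of the line `uf` on which `a` lies decides which border ray is crossed first.
  rcases lt_or_gt_of_ne hE with hE | hE
  · right
    have hxa0 : xa < 0 := by
      by_contra hc
      push Not at hc
      have : 0 < ya := by
        by_contra h; push Not at h; nlinarith [mul_nonneg hc hyf0.le]
      exact ha' ⟨this.le, hc⟩
    have hpos : 0 < xf - xa := by linarith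
    have ht1 : xf / (xf - xa) < 1 := by rw [div_lt_one hpos]; linarith
    obtain ⟨h1, h2, h3⟩ := key (xf / (xf - xa)) (div_pos hxf0 hpos) ht1
    have hx : xf + xf / (xf - xa) * (xa - xf) = 0 := by field_simp; ring
    have hy : yf + xf / (xf - xa) * (ya - yf) = (xf * ya - xa * yf) / (xf - xa) := by
      field_simp; ring
    rw [hx, hy] at h3
    have hy0 : 0 < (xf * ya - xa * yf) / (xf - xa) := div_pos (by linarith) hpos
    rw [hline _ _ _ h3] at h2
    set y := (xf * ya - xa * yf) / (xf - xa)
    refine ⟨_, mem_openSegment_iff_sub.mpr ⟨y, hy0, ?_, by rw [h3, zero_smul, zero_add]⟩, h1⟩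
    -- Beyond `w` the ray is no longer on the side of `u`.
    by_contra hc
    push Not at hc
    nlinarith [mul_nonneg hy0.le hwl]
  · left
    have hya0 : ya < 0 := by
      by_contra hc
      push Not at hc
      have : 0 < xa := by
        by_contra h; push Not at h; nlinarith [mul_nonneg hc hxf0.le]
      exact ha' ⟨hc, this.le⟩
    have hpos : 0 < yf - ya := by linarith
    have ht1 : yf / (yf - ya) < 1 := by rw [div_lt_one hpos]; linarith
    obtain ⟨h1, h2, h3⟩ := key (yf / (yf - ya)) (div_pos hyf0 hpos) ht1
    have hy : yf + yf / (yf - ya) * (ya - yf) = 0 := by field_simp; ring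
    have hx : xf + yf / (yf - ya) * (xa - xf) = (xa * yf - xf * ya) / (yf - ya) := by
      field_simp; ring
    rw [hx, hy] at h3
    have hx0 : 0 < (xa * yf - xf * ya) / (yf - ya) := div_pos hE hpos
    rw [hline _ _ _ h3] at h2
    set x := (xa * yf - xf * ya) / (yf - ya)
    refine ⟨_, mem_openSegment_iff_sub.mpr ⟨x, hx0, ?_, by rw [h3, zero_smul, add_zero]⟩, h1⟩
    by_contra hc
    push Not at hc
    nlinarith

theorem ProperlyIntersect.swap_right {a b c d : Plane} (h : ProperlyIntersect a b c d) :
    ProperlyIntersect a b d c := by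
  obtain ⟨p, hp⟩ := h
  exact ⟨p, by rwa [openSegment_symm ℝ d c]⟩

/-- Segments with a common endpoint either coincide or, without three collinear vertices, have
disjoint interiors. -/
theorem ne_of_properlyIntersect {m : ℕ} {P : Finset Plane} (hP : GeneralPosition m P)
    {u q a b : P} (huq : u ≠ q) (hab : a ≠ b) (h : ProperlyIntersect (u : Plane) q a b) :
    a ≠ u := by
  rintro rfl
  obtain ⟨f, hf⟩ := h
  have hf' : f ∈ openSegment ℝ (a : Plane) q ∩ openSegment ℝ (a : Plane) b := by
    rw [hf]; exact Set.mem_singleton f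
  obtain ⟨t, ht0, _, ht⟩ := mem_openSegment_iff_sub.mp hf'.1
  obtain ⟨s, hs0, _, hs⟩ := mem_openSegment_iff_sub.mp hf'.2
  by_cases hqb : q = b
  · subst hqb
    exact not_properlyIntersect_self (a : Plane) q (fun h => huq (Subtype.ext h)) ⟨f, hf⟩
  · have h1 : turn 1 (f - a) (f - a) = 0 := turn_self _ _
    nth_rewrite 1 [ht] at h1
    rw [hs, turn_smul_left, turn_smul_right] at h1
    have := hP.turn_ne_zero (σ := 1) one_ne_zero huq hab hqb
    exact this ((mul_eq_zero.mp ((mul_eq_zero.mp h1).resolve_left ht0.ne')).resolve_left hs0.ne')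

theorem turn_sub_sub (σ : ℝ) (u p q : Plane) :
    turn σ (q - p) (u - p) = - turn σ (q - u) (p - u) := by
  simp only [turn, cross, PiLp.sub_apply]; ring

theorem sub_mem_segment {a b f u : Plane} {s : ℝ} (hs : f - a = s • (b - a)) :
    f - u = (1 - s) • (a - u) + s • (b - u) := by
  have : f - u = (f - a) + (a - u) := by abel
  rw [this, hs]; module

/-! ### Convex chains in a wedge -/

/-- The closed wedge with apex `u`, from the ray through `p` to the ray through `w`. -/
def Wedge (σ : ℝ) (u p w z : Plane) : Prop :=
  0 ≤ turn σ (z - u) (p - u) ∧ 0 ≤ turn σ (w - u) (z - u)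

/-- One gift-wrapping step: among the directions from `p` to vertices of the wedge, the one turned
most towards `u` is taken. -/
theorem exists_extreme {m : ℕ} {P : Finset Plane} (hP : GeneralPosition m P) {σ : ℝ} (hσ : σ ≠ 0)
    {u p w : P} (hD : 0 < turn σ ((w : Plane) - u) (p - u)) :
    ∃ q : P, q ≠ u ∧ q ≠ p ∧ Wedge σ (u : Plane) p w q ∧
      ∀ z : P, z ≠ u → z ≠ p → Wedge σ (u : Plane) p w z →
        0 ≤ turn σ ((q : Plane) - p) (z - p) := by
  have hup : u ≠ p := by rintro rfl; simp [turn, cross] at hD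
  have huw : w ≠ u := by rintro rfl; simp [turn, cross] at hD
  have hpw : w ≠ p := by rintro rfl; rw [turn_self] at hD; exact hD.false
  -- If `z - p = a • (w - u) + b • (p - u)`, the minimized quotient is `b / a`.
  obtain ⟨q, ⟨hq1, hq2, hq3⟩, hq⟩ := Set.exists_min_image
    {z : P | z ≠ u ∧ z ≠ p ∧ Wedge σ (u : Plane) p w z}
    (fun z => turn σ ((w : Plane) - u) (z - p) / turn σ ((z : Plane) - p) (p - u))
    (Set.toFinite _) ⟨w, huw, hpw, hD.le, by rw [turn_self]⟩
  refine ⟨q, hq1, hq2, hq3, fun z hz1 hz2 hz3 => ?_⟩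
  have hpos : ∀ z : P, z ≠ u → z ≠ p → Wedge σ (u : Plane) p w z →
      0 < turn σ ((z : Plane) - p) (p - u) := by
    intro z hz1 hz2 hz
    have e : turn σ ((z : Plane) - p) (p - u) = turn σ ((z : Plane) - u) (p - u) := by
      simp only [turn, cross, PiLp.sub_apply]; ring
    rw [e]
    exact lt_of_le_of_ne hz.1 (hP.turn_ne_zero hσ hz1.symm hup hz2).symm
  have h1 := hq z ⟨hz1, hz2, hz3⟩
  rw [div_le_div_iff₀ (hpos q hq1 hq2 hq3) (hpos z hz1 hz2 hz3)] at h1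
  have e : turn σ ((w : Plane) - u) (p - u) * turn σ ((q : Plane) - p) (z - p) =
      turn σ ((w : Plane) - u) (z - p) * turn σ ((q : Plane) - p) (p - u) -
      turn σ ((w : Plane) - u) (q - p) * turn σ ((z : Plane) - p) (p - u) := by
    simp only [turn, cross, PiLp.sub_apply]; ring
  by_contra hc
  push Not at hc
  nlinarith [mul_neg_of_pos_of_neg hD hc]

/-- One step of the convex chain from `p` to `w` in the wedge with apex `u`. -/
theorem exists_next {m : ℕ} {P : Finset Plane} (hP : GeneralPosition m P) {S : SimpleGraph P}
    (hS : PlanarConstraints S) {σ : ℝ} (hσ : σ ≠ 0) {u p w : P}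
    (hD : 0 < turn σ ((w : Plane) - u) (p - u)) (hp : CanSee S u p) (hw : CanSee S u w)
    (hN : ∀ z : P, S.Adj u z →
      ¬ (0 < turn σ ((z : Plane) - u) (p - u) ∧ 0 < turn σ ((w : Plane) - u) (z - u))) :
    ∃ q : P, q ≠ u ∧ q ≠ p ∧ Wedge σ (u : Plane) p w q ∧ CanSee S p q ∧ CanSee S u q ∧
      0 < turn σ ((q : Plane) - u) (p - u) ∧
      ∀ z : P, z ≠ u → z ≠ p → Wedge σ (u : Plane) p w z →
        0 ≤ turn σ ((q : Plane) - p) (z - p) := by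
  have hup : u ≠ p := by rintro rfl; simp [turn, cross] at hD
  have huw : w ≠ u := by rintro rfl; simp [turn, cross] at hD
  have hpw : w ≠ p := by rintro rfl; rw [turn_self] at hD; exact hD.false
  obtain ⟨q, hqu, hqp, hqW, hq⟩ := exists_extreme hP hσ hD
  have hqpos : 0 < turn σ ((q : Plane) - u) (p - u) :=
    lt_of_le_of_ne hqW.1 (hP.turn_ne_zero hσ hqu.symm hup hqp).symm
  have hul : turn σ ((q : Plane) - p) (u - p) < 0 := by
    rw [turn_sub_sub]; linarith
  have hwl : 0 ≤ turn σ ((q : Plane) - p) (w - p) :=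
    hq w huw hpw ⟨hD.le, by rw [turn_self]⟩
  -- An endpoint `a` strictly on the side of `u` is outside the wedge by extremality of `q`, so the
  -- constraint leaves through `up` or `uw`, which are visible.
  have main : ∀ (f : Plane) (a b : P), S.Adj a b → 0 < turn σ (f - u) (p - u) →
      0 < turn σ ((w : Plane) - u) (f - u) → turn σ ((q : Plane) - p) (f - p) ≤ 0 →
      f ∈ openSegment ℝ (a : Plane) b → turn σ ((q : Plane) - p) (a - p) < 0 → a ≠ u → b ≠ u →
      False := by
    intro f a b hab h1 h2 h3 hf ha hau hbu
    have hap : a ≠ p := by rintro rfl; simp [turn, cross] at ha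
    have haw : a ≠ w := by rintro rfl; exact absurd ha hwl.not_gt
    obtain ⟨s, hs0, _, hs⟩ := mem_openSegment_iff_sub.mp hf
    have hcol : turn σ (f - u) ((a : Plane) - u) ≠ 0 := by
      rw [sub_mem_segment (u := (u : Plane)) hs, turn_add_left, turn_smul_left, turn_self,
        mul_zero, zero_add, turn_smul_left]
      exact mul_ne_zero hs0.ne' (hP.turn_ne_zero hσ hbu.symm hau.symm hab.ne.symm)
    rcases exists_mem_openSegment_of_exit hD h1 h2 h3 ha hul hwl
      (fun h => absurd ha (hq a hau hap h).not_gt) hf hcol with ⟨g, hg, hg'⟩ | ⟨g, hg, hg'⟩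
    · exact hp.not_properlyIntersect hS hab
        (properlyIntersect_of_mem (hP.turn_ne_zero hσ hup hau.symm hap.symm) hg hg')
    · exact hw.not_properlyIntersect hS hab
        (properlyIntersect_of_mem (hP.turn_ne_zero hσ huw.symm hau.symm haw.symm) hg hg')
  refine ⟨q, hqu, hqp, hqW, Or.inl ?_, ?_, hqpos, hq⟩
  · have aux : ∀ (f : Plane) (a b : P), S.Adj a b → f ∈ openSegment ℝ (p : Plane) q →
        f ∈ openSegment ℝ (a : Plane) b → turn σ ((q : Plane) - p) (a - p) < 0 → False := by
      intro f a b hab hf hf' ha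
      obtain ⟨t, ht0, ht1, ht⟩ := mem_openSegment_iff_sub.mp hf
      obtain ⟨s, hs0, hs1, hs⟩ := mem_openSegment_iff_sub.mp hf'
      have hfu := sub_mem_segment (u := (u : Plane)) ht
      have h1 : 0 < turn σ (f - u) ((p : Plane) - u) := by
        rw [hfu, turn_add_left, turn_smul_left, turn_smul_left, turn_self]
        nlinarith
      have h2 : 0 < turn σ ((w : Plane) - u) (f - u) := by
        rw [hfu, turn_add_right, turn_smul_right, turn_smul_right]
        have := hqW.2
        nlinarith [mul_pos (sub_pos.mpr ht1) hD, mul_nonneg ht0.le this]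
      have h3 : turn σ ((q : Plane) - p) (f - p) = 0 := by
        rw [ht, turn_smul_right, turn_self, mul_zero]
      have hb : 0 < turn σ ((q : Plane) - p) (b - p) := by
        rw [sub_mem_segment (u := (p : Plane)) hs, turn_add_right, turn_smul_right,
          turn_smul_right] at h3
        by_contra hc
        push Not at hc
        nlinarith [mul_neg_of_pos_of_neg (sub_pos.mpr hs1) ha,
          mul_nonneg hs0.le (neg_nonneg.mpr hc)]
      have hbu : b ≠ u := by rintro rfl; linarith
      -- A constraint starting at `u` does not leave the wedge; it is excluded by `hN` instead.
      by_cases hau : a = u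
      · subst hau
        refine hN b hab ⟨?_, ?_⟩
        · rw [hs, turn_smul_left] at h1
          exact pos_of_mul_pos_right h1 hs0.le
        · rw [hs, turn_smul_right] at h2
          exact pos_of_mul_pos_right h2 hs0.le
      · exact main f a b hab h1 h2 h3.le hf' ha hau hbu
    intro a b hab hpr
    obtain ⟨f, hf⟩ := id hpr
    have hf' : f ∈ openSegment ℝ (p : Plane) q ∩ openSegment ℝ (a : Plane) b := by
      rw [hf]; exact Set.mem_singleton f
    obtain ⟨t, _, _, ht⟩ := mem_openSegment_iff_sub.mp hf'.1
    obtain ⟨s, hs0, hs1, hs⟩ := mem_openSegment_iff_sub.mp hf'.2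
    have h3 : turn σ ((q : Plane) - p) (f - p) = 0 := by
      rw [ht, turn_smul_right, turn_self, mul_zero]
    rw [sub_mem_segment (u := (p : Plane)) hs, turn_add_right, turn_smul_right,
      turn_smul_right] at h3
    have hap := ne_of_properlyIntersect hP hqp.symm hab.ne hpr
    have haq := ne_of_properlyIntersect hP hqp hab.ne hpr.swap_left
    have hA : turn σ ((q : Plane) - p) (a - p) ≠ 0 :=
      hP.turn_ne_zero hσ hqp.symm hap.symm haq.symm
    rcases lt_or_gt_of_ne hA with hA | hA
    · exact aux f a b hab hf'.1 hf'.2 hA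
    · refine aux f b a hab.symm hf'.1 (by rw [openSegment_symm]; exact hf'.2) ?_
      by_contra hc
      push Not at hc
      nlinarith [mul_pos (sub_pos.mpr hs1) hA, mul_nonneg hs0.le hc]
  · by_cases hqw : q = w
    · rwa [hqw]
    refine Or.inl ?_
    intro a b hab hpr
    obtain ⟨f, hf⟩ := id hpr
    have hf' : f ∈ openSegment ℝ (u : Plane) q ∩ openSegment ℝ (a : Plane) b := by
      rw [hf]; exact Set.mem_singleton f
    obtain ⟨t, ht0, ht1, ht⟩ := mem_openSegment_iff_sub.mp hf'.1
    obtain ⟨s, hs0, hs1, hs⟩ := mem_openSegment_iff_sub.mp hf'.2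
    have hqw' : 0 < turn σ ((w : Plane) - u) (q - u) :=
      lt_of_le_of_ne hqW.2 (hP.turn_ne_zero hσ huw.symm hqu.symm (Ne.symm hqw)).symm
    have h1 : 0 < turn σ (f - u) ((p : Plane) - u) := by
      rw [ht, turn_smul_left]; exact mul_pos ht0 hqpos
    have h2 : 0 < turn σ ((w : Plane) - u) (f - u) := by
      rw [ht, turn_smul_right]; exact mul_pos ht0 hqw'
    have h3 : turn σ ((q : Plane) - p) (f - p) < 0 := by
      rw [sub_mem_segment (u := (p : Plane)) ht, turn_add_right, turn_smul_right,
        turn_smul_right, turn_self, mul_zero, add_zero]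
      exact mul_neg_of_pos_of_neg (by linarith) hul
    have hau := ne_of_properlyIntersect hP hqu.symm hab.ne hpr
    have hbu := ne_of_properlyIntersect hP hqu.symm hab.ne.symm hpr.swap_right
    by_cases hA : turn σ ((q : Plane) - p) (a - p) < 0
    · exact main f a b hab h1 h2 h3.le hf'.2 hA hau hbu
    · refine main f b a hab.symm h1 h2 h3.le (by rw [openSegment_symm]; exact hf'.2) ?_ hbu hau
      rw [sub_mem_segment (u := (p : Plane)) hs, turn_add_right, turn_smul_right,
        turn_smul_right] at h3
      by_contra hc
      push Not at hA hc
      nlinarith [mul_nonneg (sub_pos.mpr hs1).le hA, mul_nonneg hs0.le hc]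

/-! ### Coordinate frames of the cones -/

/-- A coordinate frame whose second axis is the bisector of the `j`-th cone; the first axis points
to the right of the bisector if `σ = 1` and to the left if `σ = -1`. -/
structure Frame (m : ℕ) where
  j : ℤ
  σ : ℤ
  hσ : σ = 1 ∨ σ = -1

namespace Frame

variable {m : ℕ} (F : Frame m)

/-- The coordinate along the first axis. -/
def X (d : Plane) : ℝ :=
  F.σ * (d 0 * Real.cos (F.j * aperture m) - d 1 * Real.sin (F.j * aperture m))

/-- The coordinate along the bisector. -/
def Y (d : Plane) : ℝ :=
  d 0 * Real.sin (F.j * aperture m) + d 1 * Real.cos (F.j * aperture m)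

/-- The vector `d` points into the cone of the frame. -/
def InCone (d : Plane) : Prop :=
  |F.X d| * Real.cos (aperture m / 2) ≤ Real.sin (aperture m / 2) * F.Y d

theorem X_add (x y : Plane) : F.X (x + y) = F.X x + F.X y := by
  simp only [X, PiLp.add_apply]; ring

theorem Y_add (x y : Plane) : F.Y (x + y) = F.Y x + F.Y y := by
  simp only [Y, PiLp.add_apply]; ring

theorem X_sub (x y : Plane) : F.X (x - y) = F.X x - F.X y := by
  simp only [X, PiLp.sub_apply]; ring

theorem Y_sub (x y : Plane) : F.Y (x - y) = F.Y x - F.Y y := by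
  simp only [Y, PiLp.sub_apply]; ring

theorem X_smul (t : ℝ) (x : Plane) : F.X (t • x) = t * F.X x := by
  simp only [X, PiLp.smul_apply, smul_eq_mul]; ring

theorem Y_smul (t : ℝ) (x : Plane) : F.Y (t • x) = t * F.Y x := by
  simp only [Y, PiLp.smul_apply, smul_eq_mul]; ring

theorem sigma_sq : (F.σ : ℝ) * F.σ = 1 := by
  rcases F.hσ with h | h <;> simp [h]

theorem sigma_ne_zero : (F.σ : ℝ) ≠ 0 := by
  rcases F.hσ with h | h <;> simp [h]

theorem turn_eq (x y : Plane) : turn F.σ x y = F.X x * F.Y y - F.Y x * F.X y := by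
  have h := Real.sin_sq_add_cos_sq (F.j * aperture m)
  simp only [turn, cross, X, Y]
  linear_combination (-(F.σ : ℝ) * (x 0 * y 1 - x 1 * y 0)) * h

theorem norm_sq (d : Plane) : ‖d‖ ^ 2 = F.X d ^ 2 + F.Y d ^ 2 := by
  have h := Real.sin_sq_add_cos_sq (F.j * aperture m)
  have hs := F.sigma_sq
  rw [EuclideanSpace.norm_sq_eq, Fin.sum_univ_two]
  simp only [X, Y, Real.norm_eq_abs, sq_abs]
  linear_combination (-(d 0 ^ 2 + d 1 ^ 2)) * h -
    (d 0 * Real.cos (F.j * aperture m) - d 1 * Real.sin (F.j * aperture m)) ^ 2 * hs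

theorem ext_coord {x y : Plane} (hX : F.X x = F.X y) (hY : F.Y x = F.Y y) : x = y := by
  have : ‖x - y‖ ^ 2 = 0 := by
    rw [F.norm_sq, F.X_sub, F.Y_sub, hX, hY]; ring
  rw [← sub_eq_zero, ← norm_eq_zero]
  exact pow_eq_zero_iff two_ne_zero |>.mp this

theorem inner_eq_Y {i : ℕ} (hc : Real.cos (F.j * aperture m) = Real.cos (i * aperture m))
    (hs : Real.sin (F.j * aperture m) = Real.sin (i * aperture m)) (d : Plane) :
    ⟪d, bisectorDir m i⟫ = F.Y d := by
  simp only [bisectorDir, unitVec, Y, hc, hs, PiLp.inner_apply, Fin.sum_univ_two,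
    Real.cos_pi_div_two_sub, Real.sin_pi_div_two_sub]
  simp [mul_comm]

theorem X_rayDir {i : ℕ} (hc : Real.cos (F.j * aperture m) = Real.cos (i * aperture m))
    (hs : Real.sin (F.j * aperture m) = Real.sin (i * aperture m)) :
    F.X (rayDir m i) = - F.σ * Real.sin (aperture m / 2) ∧
      F.Y (rayDir m i) = Real.cos (aperture m / 2) ∧
      F.X (rayDir m (i + 1)) = F.σ * Real.sin (aperture m / 2) ∧
      F.Y (rayDir m (i + 1)) = Real.cos (aperture m / 2) := by
  have h := Real.sin_sq_add_cos_sq (i * aperture m)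
  have e1 : Real.pi / 2 + aperture m / 2 - i * aperture m =
      Real.pi / 2 - (i * aperture m - aperture m / 2) := by ring
  have e2 : Real.pi / 2 + aperture m / 2 - (↑(i + 1)) * aperture m =
      Real.pi / 2 - (i * aperture m + aperture m / 2) := by push_cast; ring
  simp only [rayDir, unitVec, e1, e2, Y, X, hc, hs, Real.cos_pi_div_two,
    Real.sin_pi_div_two, Real.sin_sub, Real.cos_sub, Real.sin_add, Real.cos_add]
  simp only [Matrix.cons_val_zero, Matrix.cons_val_one, Matrix.cons_val_fin_one]
  refine ⟨?_, ?_, ?_, ?_⟩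
  · linear_combination (- (F.σ : ℝ) * Real.sin (aperture m / 2)) * h
  · linear_combination Real.cos (aperture m / 2) * h
  · linear_combination ((F.σ : ℝ) * Real.sin (aperture m / 2)) * h
  · linear_combination Real.cos (aperture m / 2) * h

/-- Frames carry an arbitrary integer index so that they can be rotated freely; modulo `m` they are
the actual cones. -/
theorem exists_index (hm : 0 < m) : ∃ i < m,
    Real.cos (F.j * aperture m) = Real.cos (i * aperture m) ∧
      Real.sin (F.j * aperture m) = Real.sin (i * aperture m) := by
  have hm' : (m : ℤ) ≠ 0 := by exact_mod_cast hm.ne'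
  have h0 := Int.emod_nonneg F.j hm'
  have h1 := Int.emod_lt_of_pos F.j (by exact_mod_cast hm : (0 : ℤ) < m)
  refine ⟨(F.j % m).toNat, by omega, ?_⟩
  have hi : (((F.j % m).toNat : ℕ) : ℝ) = ((F.j % m : ℤ) : ℝ) := by
    exact_mod_cast congrArg (Int.cast : ℤ → ℝ) (Int.toNat_of_nonneg h0)
  have hj : (F.j : ℝ) = ((F.j % m : ℤ) : ℝ) + m * ((F.j / m : ℤ) : ℝ) := by
    exact_mod_cast congrArg (Int.cast : ℤ → ℝ) (Int.emod_add_mul_ediv F.j m).symm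
  have hm0 : (m : ℝ) ≠ 0 := by exact_mod_cast hm.ne'
  have e : (F.j : ℝ) * aperture m =
      ((F.j % m).toNat : ℕ) * aperture m + ((F.j / m : ℤ) : ℝ) * (2 * Real.pi) := by
    rw [hi, hj, aperture]; field_simp
  rw [e]
  exact ⟨Real.cos_add_int_mul_two_pi _ _, Real.sin_add_int_mul_two_pi _ _⟩

theorem InCone.combination {F : Frame m} (hc : 0 ≤ Real.cos (aperture m / 2)) {x y : Plane}
    (hx : F.InCone x) (hy : F.InCone y)
    {a b : ℝ} (ha : 0 ≤ a) (hb : 0 ≤ b) : F.InCone (a • x + b • y) := by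
  unfold InCone at *
  rw [X_add, Y_add, X_smul, X_smul, Y_smul, Y_smul]
  calc |a * F.X x + b * F.X y| * Real.cos (aperture m / 2)
      ≤ (a * |F.X x| + b * |F.X y|) * Real.cos (aperture m / 2) := by
        refine mul_le_mul_of_nonneg_right ((abs_add_le _ _).trans ?_) hc
        rw [abs_mul, abs_mul, abs_of_nonneg ha, abs_of_nonneg hb]
    _ ≤ _ := by nlinarith [mul_le_mul_of_nonneg_left hx ha, mul_le_mul_of_nonneg_left hy hb]

end Frame

theorem aperture_half_pos {m : ℕ} (hm : 3 ≤ m) : 0 < aperture m / 2 := by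
  have : (0 : ℝ) < m := by exact_mod_cast (by omega : 0 < m)
  unfold aperture
  positivity

theorem aperture_half_lt {m : ℕ} (hm : 3 ≤ m) : aperture m / 2 < Real.pi / 2 := by
  have h3 : (3 : ℝ) ≤ m := by exact_mod_cast hm
  have : aperture m / 2 = Real.pi / m := by unfold aperture; ring
  rw [this]
  exact div_lt_div_of_pos_left Real.pi_pos (by norm_num) (by linarith)

theorem cos_aperture_half_pos {m : ℕ} (hm : 3 ≤ m) : 0 < Real.cos (aperture m / 2) :=
  Real.cos_pos_of_mem_Ioo ⟨by have := aperture_half_pos hm; linarith [Real.pi_pos],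
    aperture_half_lt hm⟩

theorem sin_aperture_half_pos {m : ℕ} (hm : 3 ≤ m) : 0 < Real.sin (aperture m / 2) :=
  Real.sin_pos_of_pos_of_lt_pi (aperture_half_pos hm)
    (by linarith [aperture_half_lt hm, Real.pi_pos])

theorem rayDir_self {m : ℕ} (hm : 0 < m) : rayDir m m = rayDir m 0 := by
  have hm0 : (m : ℝ) ≠ 0 := by exact_mod_cast hm.ne'
  have e : Real.pi / 2 + aperture m / 2 - m * aperture m =
      Real.pi / 2 + aperture m / 2 - (0 : ℕ) * aperture m - 2 * Real.pi := by
    unfold aperture; field_simp; push_cast; ring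
  simp only [rayDir, unitVec, e, Real.cos_sub_two_pi, Real.sin_sub_two_pi]

namespace Frame

variable {m : ℕ} {F : Frame m}

theorem mem_cone_iff (hm : 3 ≤ m) {i : ℕ}
    (hc : Real.cos (F.j * aperture m) = Real.cos (i * aperture m))
    (hs : Real.sin (F.j * aperture m) = Real.sin (i * aperture m)) {u w : Plane} :
    w ∈ cone m i u ↔ F.InCone (w - u) := by
  have hcos := cos_aperture_half_pos hm
  have hsin := sin_aperture_half_pos hm
  obtain ⟨h1, h2, h3, h4⟩ := F.X_rayDir hc hs
  have habs : |(F.σ : ℝ)| = 1 := by rcases F.hσ with h | h <;> simp [h]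
  have hray : F.InCone (rayDir m i) := by
    unfold InCone; rw [h1, h2, abs_mul, abs_neg, habs, abs_of_pos hsin, one_mul]
  have hray' : F.InCone (rayDir m (i + 1)) := by
    unfold InCone; rw [h3, h4, abs_mul, habs, abs_of_pos hsin, one_mul]
  constructor
  · rintro ⟨a, b, ha, hb, rfl⟩
    have : u + a • rayDir m i + b • rayDir m (i + 1) - u =
      a • rayDir m i + b • rayDir m (i + 1) := by abel
    rw [this]
    exact hray.combination hcos.le hray' ha hb
  · intro h
    have hX := abs_le.mp (le_of_eq (abs_mul (F.σ : ℝ) (F.X (w - u))) |>.trans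
      (by rw [habs, one_mul] : (|(F.σ : ℝ)| * |F.X (w - u)|) = |F.X (w - u)|).le)
    unfold InCone at h
    set x := F.X (w - u)
    set y := F.Y (w - u)
    set s := Real.sin (aperture m / 2)
    set c := Real.cos (aperture m / 2)
    have hss := F.sigma_sq
    -- The coefficients solve the linear system in the two border directions `(∓σ s, c)`.
    refine ⟨(y * s - F.σ * x * c) / (2 * s * c), (y * s + F.σ * x * c) / (2 * s * c),
      div_nonneg (by nlinarith) (by positivity), div_nonneg (by nlinarith) (by positivity), ?_⟩
    rw [add_assoc, ← sub_eq_iff_eq_add']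
    apply F.ext_coord
    · rw [F.X_add, F.X_smul, F.X_smul, h1, h3]
      change x = _
      field_simp
      linear_combination (-2 * x * c) * hss
    · rw [F.Y_add, F.Y_smul, F.Y_smul, h2, h4]
      change y = _
      field_simp
      ring

theorem Y_ne_zero (hm : 0 < m) {P : Finset Plane} (hP : GeneralPosition m P) {p q : P}
    (hpq : p ≠ q) : F.Y ((q : Plane) - p) ≠ 0 := by
  obtain ⟨i, hi, hc, hs⟩ := F.exists_index hm
  rw [← F.inner_eq_Y hc hs]
  exact hP.not_perpendicular p p.2 q q.2 (fun h => hpq (Subtype.ext h)) i hi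

/-- Equality would put `p` and `q` on a line parallel to a cone ray. The right border has index `i +
1`, possibly `m`, hence `rayDir_self`. -/
theorem InCone.lt (hm : 3 ≤ m) {P : Finset Plane} (hP : GeneralPosition m P) {p q : P}
    (hpq : p ≠ q) (h : F.InCone ((q : Plane) - p)) :
    |F.X ((q : Plane) - p)| * Real.cos (aperture m / 2) <
      Real.sin (aperture m / 2) * F.Y ((q : Plane) - p) := by
  refine lt_of_le_of_ne h fun heq => ?_
  obtain ⟨i, hi, hc, hs⟩ := F.exists_index (by omega)
  obtain ⟨h1, h2, h3, h4⟩ := F.X_rayDir hc hs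
  have hcos := cos_aperture_half_pos hm
  have hpq' : (p : Plane) ≠ q := fun h => hpq (Subtype.ext h)
  have hnot : ∀ i ≤ m, ∀ t : ℝ, (q : Plane) - p ≠ t • rayDir m i := by
    intro i hi t
    rcases hi.lt_or_eq with hi | rfl
    · exact hP.not_parallel p p.2 q q.2 hpq' i hi t
    · rw [rayDir_self (by omega)]
      exact hP.not_parallel p p.2 q q.2 hpq' 0 (by omega) t
  have hY : F.Y ((q : Plane) - p) =
      F.Y ((q : Plane) - p) / Real.cos (aperture m / 2) * Real.cos (aperture m / 2) := by
    field_simp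
  have hss := F.sigma_sq
  have hcase : F.X ((q : Plane) - p) * Real.cos (aperture m / 2) =
        - F.σ * Real.sin (aperture m / 2) * F.Y ((q : Plane) - p) ∨
      F.X ((q : Plane) - p) * Real.cos (aperture m / 2) =
        F.σ * Real.sin (aperture m / 2) * F.Y ((q : Plane) - p) := by
    rcases F.hσ with h | h <;> rcases abs_choice (F.X ((q : Plane) - p)) with h' | h' <;>
      rw [h'] at heq <;> simp only [h, Int.cast_one, Int.cast_neg]
    · right; linarith
    · left; linarith
    · left; linarith
    · right; linarith
  rcases hcase with h | h
  · refine hnot i hi.le (F.Y ((q : Plane) - p) / Real.cos (aperture m / 2)) (F.ext_coord ?_ ?_)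
    · rw [X_smul, h1]; field_simp; linarith
    · rw [Y_smul, h2]; exact hY
  · refine hnot (i + 1) hi (F.Y ((q : Plane) - p) / Real.cos (aperture m / 2)) (F.ext_coord ?_ ?_)
    · rw [X_smul, h3]; field_simp; linarith
    · rw [Y_smul, h4]; exact hY

theorem InCone.Y_pos (hm : 3 ≤ m) {P : Finset Plane} (hP : GeneralPosition m P) {p q : P}
    (hpq : p ≠ q) (h : F.InCone ((q : Plane) - p)) : 0 < F.Y ((q : Plane) - p) := by
  have h1 := h.lt hm hP hpq
  have h2 := mul_nonneg (abs_nonneg (F.X ((q : Plane) - p))) (cos_aperture_half_pos hm).le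
  exact pos_of_mul_pos_right (h2.trans_lt h1) (sin_aperture_half_pos hm).le

end Frame

/-! ### Subcones and the edge added in them -/

theorem splitDirs_finite {P : Finset Plane} (S : SimpleGraph P) (m : ℕ) (u : P) (i : ℕ) :
    (splitDirs S m u i).Finite := by
  refine Set.Finite.union (Set.toFinite _)
    ((Set.finite_range fun v : P => (v : Plane) - u).subset ?_)
  rintro d ⟨v, _, _, rfl⟩
  exact ⟨v, rfl⟩

theorem combination_mem_sector {u r s v w z : Plane} (hv : v ∈ sector u r s) (hw : w ∈ sector u r s)
    {a b : ℝ} (ha : 0 ≤ a) (hb : 0 ≤ b) (hz : z - u = a • (v - u) + b • (w - u)) :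
    z ∈ sector u r s := by
  obtain ⟨a1, b1, ha1, hb1, rfl⟩ := hv
  obtain ⟨a2, b2, ha2, hb2, rfl⟩ := hw
  refine ⟨a * a1 + b * a2, a * b1 + b * b2, by positivity, by positivity, ?_⟩
  rw [sub_eq_iff_eq_add] at hz
  rw [hz]
  module

theorem Wedge.exists_combination {σ : ℝ} {u p w z : Plane} (hD : 0 < turn σ (w - u) (p - u))
    (h : Wedge σ u p w z) : ∃ a b : ℝ, 0 ≤ a ∧ 0 ≤ b ∧ z - u = a • (p - u) + b • (w - u) :=
  ⟨_, _, div_nonneg h.2 hD.le, div_nonneg h.1 hD.le, eq_combination hD.ne' (z - u)⟩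

section Subcone

variable {m : ℕ} {P : Finset Plane} {S : SimpleGraph P} {F : Frame m} {u w : P} {i : ℕ}

theorem Frame.inCone_of_mem_splitDirs (hm : 3 ≤ m)
    (hc : Real.cos (F.j * aperture m) = Real.cos (i * aperture m))
    (hs : Real.sin (F.j * aperture m) = Real.sin (i * aperture m)) {d : Plane}
    (hd : d ∈ splitDirs S m u i) : F.InCone d := by
  have h : ∀ d : Plane, (u : Plane) + d ∈ cone m i u → F.InCone d := by
    intro d hd
    rwa [F.mem_cone_iff hm hc hs, add_sub_cancel_left] at hd
  rcases hd with (rfl | rfl) | ⟨v, _, hv, rfl⟩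
  · exact h _ ⟨1, 0, zero_le_one, le_rfl, by simp⟩
  · exact h _ ⟨0, 1, le_rfl, zero_le_one, by simp⟩
  · exact h _ (by rwa [add_sub_cancel])

theorem Frame.Y_pos_of_mem_splitDirs (hm : 3 ≤ m) (hP : GeneralPosition m P)
    (hc : Real.cos (F.j * aperture m) = Real.cos (i * aperture m))
    (hs : Real.sin (F.j * aperture m) = Real.sin (i * aperture m)) {d : Plane}
    (hd : d ∈ splitDirs S m u i) : 0 < F.Y d := by
  obtain ⟨h1, h2, h3, h4⟩ := F.X_rayDir hc hs
  have hcos := cos_aperture_half_pos hm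
  have hin := Frame.inCone_of_mem_splitDirs hm hc hs hd
  rcases hd with (rfl | rfl) | ⟨v, hv, _, rfl⟩
  · rwa [h2]
  · rwa [h4]
  · exact hin.Y_pos hm hP hv.ne

/-- All splitting directions have positive `Y`, so they are ordered by `X / Y`; the subcone lies
between the two values nearest to that of `w`. -/
theorem exists_isSubcone (hm : 3 ≤ m) (hP : GeneralPosition m P)
    (hc : Real.cos (F.j * aperture m) = Real.cos (i * aperture m))
    (hs : Real.sin (F.j * aperture m) = Real.sin (i * aperture m)) (hσ : F.σ = 1)
    (huw : u ≠ w) (hw : F.InCone ((w : Plane) - u)) :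
    ∃ r ∈ splitDirs S m u i, ∃ s ∈ splitDirs S m u i, 0 < cross s r ∧
      (∀ d ∈ splitDirs S m u i, ¬ (0 < cross s d ∧ 0 < cross d r)) ∧
      (w : Plane) ∈ sector (u : Plane) r s := by
  have hY : ∀ d ∈ splitDirs S m u i, 0 < F.Y d := fun d hd =>
    Frame.Y_pos_of_mem_splitDirs hm hP hc hs hd
  have hYw := hw.Y_pos hm hP huw
  have hlt := hw.lt hm hP huw
  have hcos := cos_aperture_half_pos hm
  have hcross : ∀ x y : Plane, 0 < F.Y x → 0 < F.Y y →
      (0 < cross x y ↔ F.X y / F.Y y < F.X x / F.Y x) := by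
    intro x y hx hy
    have e : cross x y = F.X x * F.Y y - F.Y x * F.X y := by
      rw [← F.turn_eq, hσ]; simp [turn]
    rw [e, div_lt_div_iff₀ hy hx, sub_pos, mul_comm (F.Y x)]
  obtain ⟨h1, h2, h3, h4⟩ := F.X_rayDir hc hs
  rw [hσ] at h1 h3
  have habs := abs_lt.mp (lt_div_iff₀ hcos |>.mpr hlt)
  -- If `w` itself splits the cone, the weak inequality here selects the subcone to its right.
  obtain ⟨r, ⟨hr1, hr2⟩, hr⟩ := Set.exists_max_image
    {d ∈ splitDirs S m u i | F.X d / F.Y d ≤ F.X ((w : Plane) - u) / F.Y ((w : Plane) - u)}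
    (fun d => F.X d / F.Y d) ((splitDirs_finite S m u i).subset (Set.sep_subset _ _))
    ⟨rayDir m i, Or.inl (Or.inl rfl), by
      rw [h1, h2, div_le_div_iff₀ hcos hYw]
      have := habs.1
      rw [← neg_div, div_lt_iff₀ hcos] at this
      push_cast; linarith⟩
  obtain ⟨s, ⟨hs1, hs2⟩, hs'⟩ := Set.exists_min_image
    {d ∈ splitDirs S m u i | F.X ((w : Plane) - u) / F.Y ((w : Plane) - u) < F.X d / F.Y d}
    (fun d => F.X d / F.Y d) ((splitDirs_finite S m u i).subset (Set.sep_subset _ _))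
    ⟨rayDir m (i + 1), Or.inl (Or.inr rfl), by
      rw [h3, h4, div_lt_div_iff₀ hYw hcos]
      have := habs.2
      rw [lt_div_iff₀ hcos] at this
      push_cast; linarith⟩
  have hsr : 0 < cross s r := (hcross s r (hY s hs1) (hY r hr1)).mpr (hr2.trans_lt hs2)
  refine ⟨r, hr1, s, hs1, hsr, fun d hd hdd => ?_, ?_⟩
  · have d1 := (hcross s d (hY s hs1) (hY d hd)).mp hdd.1
    have d2 := (hcross d r (hY d hd) (hY r hr1)).mp hdd.2
    rcases le_or_gt (F.X d / F.Y d) (F.X ((w : Plane) - u) / F.Y ((w : Plane) - u)) with h | h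
    · exact absurd d2 (hr d ⟨hd, h⟩).not_gt
    · exact absurd d1 (hs' d ⟨hd, h⟩).not_gt
  · have ht : ∀ x y : Plane, turn 1 x y = cross x y := fun x y => one_mul _
    have e := eq_combination (σ := 1) (w := s) (p := r) (by rw [ht]; exact hsr.ne')
      ((w : Plane) - u)
    simp only [ht] at e
    refine ⟨_, _, div_nonneg ?_ hsr.le, div_nonneg ?_ hsr.le,
      by rw [add_assoc, ← e, add_sub_cancel]⟩
    · exact ((hcross s _ (hY s hs1) hYw).mpr hs2).le
    · by_contra hcon
      have e' : cross ((w : Plane) - u) r = - cross r ((w : Plane) - u) := by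
        simp only [cross]; ring
      rw [e', neg_nonneg, not_le, hcross r _ (hY r hr1) hYw] at hcon
      exact absurd hr2 hcon.not_ge

theorem Frame.dist_bisectorProj (F : Frame m)
    (hc : Real.cos (F.j * aperture m) = Real.cos (i * aperture m))
    (hs : Real.sin (F.j * aperture m) = Real.sin (i * aperture m)) (u v : Plane) :
    dist u (bisectorProj m i u v) = |F.Y (v - u)| := by
  have h1 : ‖bisectorDir m i‖ = 1 := by
    rw [EuclideanSpace.norm_eq, Fin.sum_univ_two]
    simp [bisectorDir, unitVec]
  rw [bisectorProj, dist_self_add_right, norm_smul, h1, mul_one, F.inner_eq_Y hc hs,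
    Real.norm_eq_abs]

/-- The edge that `u` adds in the subcone of `w`. -/
theorem exists_addsEdge_of_eq_one (hm : 3 ≤ m) (hP : GeneralPosition m P) (hσ : F.σ = 1)
    (huw : u ≠ w) (hsee : CanSee S u w) (hw : F.InCone ((w : Plane) - u)) :
    ∃ v : P, AddsEdge S m u v ∧ F.InCone ((v : Plane) - u) ∧
      F.Y ((v : Plane) - u) ≤ F.Y ((w : Plane) - u) ∧
      (∀ σ : ℝ, 0 < turn σ ((w : Plane) - u) (v - u) → ∀ z : P, S.Adj u z →
        ¬ (0 < turn σ ((z : Plane) - u) (v - u) ∧ 0 < turn σ ((w : Plane) - u) (z - u))) ∧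
      ∀ σ : ℝ, 0 < turn σ ((w : Plane) - u) (v - u) → ∀ z : P, z ≠ u → CanSee S u z →
        Wedge σ (u : Plane) v w z → F.Y ((v : Plane) - u) ≤ F.Y ((z : Plane) - u) := by
  obtain ⟨i, hi, hc, hs⟩ := F.exists_index (by omega)
  have hcos := cos_aperture_half_pos hm
  obtain ⟨r, hr, s, hs', hsr, hempty, hwT⟩ := exists_isSubcone (S := S) hm hP hc hs hσ huw hw
  have hcone : ∀ z ∈ sector (u : Plane) r s, F.InCone (z - u) := by
    rintro z ⟨a, b, ha, hb, rfl⟩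
    have : (u : Plane) + a • r + b • s - u = a • r + b • s := by abel
    rw [this]
    exact (Frame.inCone_of_mem_splitDirs hm hc hs hr).combination hcos.le
      (Frame.inCone_of_mem_splitDirs hm hc hs hs') ha hb
  obtain ⟨v, ⟨hvu, hv, hvT⟩, hmin⟩ := Set.exists_min_image
    {z : P | z ≠ u ∧ CanSee S u z ∧ (z : Plane) ∈ sector (u : Plane) r s}
    (fun z => dist (u : Plane) (bisectorProj m i u z)) (Set.toFinite _) ⟨w, huw.symm, hsee, hwT⟩
  have hminY : ∀ z : P, z ≠ u → CanSee S u z → (z : Plane) ∈ sector (u : Plane) r s →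
      F.Y ((v : Plane) - u) ≤ F.Y ((z : Plane) - u) := by
    intro z hz1 hz2 hz3
    have h := hmin z ⟨hz1, hz2, hz3⟩
    simp only [F.dist_bisectorProj hc hs] at h
    rwa [abs_of_pos ((hcone v hvT).Y_pos hm hP hvu.symm),
      abs_of_pos ((hcone z hz3).Y_pos hm hP hz1.symm)] at h
  refine ⟨v, ⟨hvu.symm, hv, i, hi, _, ⟨r, hr, s, hs', hsr, hempty, rfl⟩, hvT,
    fun z h1 h2 h3 => hmin z ⟨h1, h2, h3⟩⟩, hcone v hvT, hminY w huw.symm hsee hwT, ?_, ?_⟩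
  -- A constraint strictly between `v` and `w` would split their common subcone. Its cross products
  -- with `r` and `s` are strictly positive, as `v - u` and `w - u` are not parallel.
  · rintro σ hD z hz ⟨h1, h2⟩
    have e := eq_combination hD.ne' ((z : Plane) - u)
    have ha := div_pos h2 hD
    have hb := div_pos h1 hD
    set a := turn σ ((w : Plane) - u) (z - u) / turn σ ((w : Plane) - u) (v - u)
    set b := turn σ ((z : Plane) - u) (v - u) / turn σ ((w : Plane) - u) (v - u)
    have hzT := combination_mem_sector hvT hwT ha.le hb.le e
    have hzS : (z : Plane) - u ∈ splitDirs S m u i :=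
      Or.inr ⟨z, hz, (F.mem_cone_iff hm hc hs).mpr (hcone z hzT), rfl⟩
    obtain ⟨a1, b1, ha1, hb1, e1⟩ := hvT
    obtain ⟨a2, b2, ha2, hb2, e2⟩ := hwT
    have e1' : (v : Plane) - u = a1 • r + b1 • s := by rw [e1]; abel
    have e2' : (w : Plane) - u = a2 • r + b2 • s := by rw [e2]; abel
    have hdet : turn σ ((w : Plane) - u) (v - u) = (a1 * b2 - a2 * b1) * turn σ s r := by
      rw [e1', e2']
      simp only [turn, cross, PiLp.add_apply, PiLp.smul_apply, smul_eq_mul]; ring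
    have hne : a1 * b2 - a2 * b1 ≠ 0 := fun h0 => by rw [hdet, h0, zero_mul] at hD; exact hD.false
    refine hempty _ hzS ⟨?_, ?_⟩
    · have : cross s ((z : Plane) - u) = (a * a1 + b * a2) * cross s r := by
        rw [e, e1', e2']
        simp only [cross, PiLp.add_apply, PiLp.smul_apply, smul_eq_mul]; ring
      rw [this]
      refine mul_pos (lt_of_le_of_ne (by positivity) fun h0 => hne ?_) hsr
      have t1 : a * a1 = 0 := by nlinarith [mul_nonneg ha.le ha1, mul_nonneg hb.le ha2]
      have t2 : b * a2 = 0 := by nlinarith [mul_nonneg ha.le ha1, mul_nonneg hb.le ha2]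
      rw [(mul_eq_zero.mp t1).resolve_left ha.ne', (mul_eq_zero.mp t2).resolve_left hb.ne']
      ring
    · have : cross ((z : Plane) - u) r = (a * b1 + b * b2) * cross s r := by
        rw [e, e1', e2']
        simp only [cross, PiLp.add_apply, PiLp.smul_apply, smul_eq_mul]; ring
      rw [this]
      refine mul_pos (lt_of_le_of_ne (by positivity) fun h0 => hne ?_) hsr
      have t1 : a * b1 = 0 := by nlinarith [mul_nonneg ha.le hb1, mul_nonneg hb.le hb2]
      have t2 : b * b2 = 0 := by nlinarith [mul_nonneg ha.le hb1, mul_nonneg hb.le hb2]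
      rw [(mul_eq_zero.mp t1).resolve_left ha.ne', (mul_eq_zero.mp t2).resolve_left hb.ne']
      ring
  · intro σ hD z hzu hz hW
    obtain ⟨a, b, ha, hb, e⟩ := hW.exists_combination hD
    exact hminY z hzu hz (combination_mem_sector hvT hwT ha hb e)

/-- The mirror image of a frame. -/
def Frame.flip (F : Frame m) : Frame m := ⟨F.j, -F.σ, by rcases F.hσ with h | h <;> simp [h]⟩

theorem Frame.X_flip (F : Frame m) (d : Plane) : F.flip.X d = - F.X d := by
  simp only [Frame.flip, Frame.X, Int.cast_neg]; ring

theorem Frame.Y_flip (F : Frame m) (d : Plane) : F.flip.Y d = F.Y d := rfl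

theorem Frame.inCone_flip (F : Frame m) (d : Plane) : F.flip.InCone d ↔ F.InCone d := by
  unfold Frame.InCone; rw [F.X_flip, F.Y_flip, abs_neg]

/-- The graph does not depend on the orientation, so a frame with `σ = -1` is mirrored. -/
theorem exists_addsEdge (hm : 3 ≤ m) (hP : GeneralPosition m P)
    (huw : u ≠ w) (hsee : CanSee S u w) (hw : F.InCone ((w : Plane) - u)) :
    ∃ v : P, AddsEdge S m u v ∧ F.InCone ((v : Plane) - u) ∧
      F.Y ((v : Plane) - u) ≤ F.Y ((w : Plane) - u) ∧
      (∀ σ : ℝ, 0 < turn σ ((w : Plane) - u) (v - u) → ∀ z : P, S.Adj u z →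
        ¬ (0 < turn σ ((z : Plane) - u) (v - u) ∧ 0 < turn σ ((w : Plane) - u) (z - u))) ∧
      ∀ σ : ℝ, 0 < turn σ ((w : Plane) - u) (v - u) → ∀ z : P, z ≠ u → CanSee S u z →
        Wedge σ (u : Plane) v w z → F.Y ((v : Plane) - u) ≤ F.Y ((z : Plane) - u) := by
  rcases F.hσ with h | h
  · exact exists_addsEdge_of_eq_one hm hP h huw hsee hw
  · have := exists_addsEdge_of_eq_one (F := F.flip) hm hP (by simp [Frame.flip, h]) huw hsee
      ((F.inCone_flip _).mpr hw)
    simpa only [F.inCone_flip, F.Y_flip] using this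

end Subcone

/-! ### Rotated frames and border paths -/

namespace Frame

variable {m : ℕ} (F : Frame m)

/-- The frame of the `n`-th next cone towards the first axis. -/
def rot (n : ℕ) : Frame m := ⟨F.j + F.σ * n, F.σ, F.hσ⟩

theorem X_rot (n : ℕ) (d : Plane) : (F.rot n).X d =
    Real.cos (n * aperture m) * F.X d - Real.sin (n * aperture m) * F.Y d := by
  rcases F with ⟨j, σ, rfl | rfl⟩ <;>
    simp only [rot, X, Y, Int.cast_add, Int.cast_one, Int.cast_neg, Int.cast_natCast,
      add_mul, one_mul, neg_mul, Real.cos_add, Real.sin_add, Real.cos_neg, Real.sin_neg] <;> ring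

theorem Y_rot (n : ℕ) (d : Plane) : (F.rot n).Y d =
    Real.cos (n * aperture m) * F.Y d + Real.sin (n * aperture m) * F.X d := by
  rcases F with ⟨j, σ, rfl | rfl⟩ <;>
    simp only [rot, X, Y, Int.cast_add, Int.cast_one, Int.cast_neg, Int.cast_natCast,
      add_mul, one_mul, neg_mul, Real.cos_add, Real.sin_add, Real.cos_neg, Real.sin_neg] <;> ring

/-- The length of the path along the left border of the canonical triangle and along its side
opposite to the apex. -/
def borderLength (d : Plane) : ℝ :=
  F.X d + (1 + Real.sin (aperture m / 2)) / Real.cos (aperture m / 2) * F.Y d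

theorem borderLength_sub (x y : Plane) :
    F.borderLength (x - y) = F.borderLength x - F.borderLength y := by
  simp only [borderLength, X_sub, Y_sub]; ring

end Frame

/-- The triangle inequality for the border path, checked by comparing squares. -/
theorem norm_le_borderLength {m : ℕ} (hm : 3 ≤ m) (F : Frame m) {d : Plane} (hd : F.InCone d) :
    ‖d‖ ≤ F.borderLength d := by
  have hcos := cos_aperture_half_pos hm
  have hsin := sin_aperture_half_pos hm
  have h1 := Real.sin_sq_add_cos_sq (aperture m / 2)
  have hn := F.norm_sq d
  unfold Frame.InCone at hd
  unfold Frame.borderLength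
  set s := Real.sin (aperture m / 2)
  set c := Real.cos (aperture m / 2)
  set x := F.X d
  set y := F.Y d
  have hx : -x * c ≤ s * y :=
    (mul_le_mul_of_nonneg_right (neg_le_abs x) hcos.le).trans hd
  have hy : 0 ≤ y := by
    have h2 := mul_nonneg (abs_nonneg x) hcos.le
    by_contra hc
    push Not at hc
    nlinarith
  have hpos : 0 ≤ x + (1 + s) / c * y := by
    have e : x + (1 + s) / c * y = (x * c + (1 + s) * y) / c := by field_simp
    rw [e]
    exact div_nonneg (by nlinarith) hcos.le
  refine abs_le_of_sq_le_sq' ?_ hpos |>.2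
  rw [hn]
  have e : (x + (1 + s) / c * y) ^ 2 - (x ^ 2 + y ^ 2) =
      2 * (1 + s) * y * (x * c + s * y) / c ^ 2 := by
    field_simp
    linear_combination (- y ^ 2) * h1
  have : 0 ≤ 2 * (1 + s) * y * (x * c + s * y) / c ^ 2 :=
    div_nonneg (mul_nonneg (mul_nonneg (by linarith) hy) (by linarith)) (sq_nonneg c)
  linarith

/-! ### Trigonometry of `4k + 2` cones -/

section Trigonometry

variable {k m : ℕ}

/-- The number of cones enters here: a right angle is an odd multiple of `θ/2`, so the perpendicular
to a bisector runs along cone borders. -/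
theorem pi_div_two_eq (hm : m = 4 * k + 2) : Real.pi / 2 = (2 * k + 1) * (aperture m / 2) := by
  have : (0 : ℝ) < 2 * k + 1 := by positivity
  rw [aperture, hm]; push_cast
  field_simp
  ring

theorem aperture_half_le (hk : 1 ≤ k) (hm : m = 4 * k + 2) :
    3 * (aperture m / 2) ≤ Real.pi / 2 := by
  have h := aperture_half_pos (m := m) (by omega)
  have hk' : (1 : ℝ) ≤ k := by exact_mod_cast hk
  rw [pi_div_two_eq hm]
  nlinarith

theorem sin_aperture_half_le (hk : 1 ≤ k) (hm : m = 4 * k + 2) :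
    Real.sin (aperture m / 2) ≤ 1 / 2 := by
  rw [← Real.sin_pi_div_six]
  have := aperture_half_le hk hm
  have h := aperture_half_pos (m := m) (by omega)
  exact Real.sin_le_sin_of_le_of_le_pi_div_two (by linarith [Real.pi_pos])
    (by linarith [Real.pi_pos]) (by linarith)

/-- This is `cos (3θ/2) ≥ 0` expanded; it needs at least six cones. -/
theorem cos_three_aperture_half (hk : 1 ≤ k) (hm : m = 4 * k + 2) :
    0 ≤ Real.cos (aperture m / 2) *
        (Real.cos (aperture m / 2) ^ 2 - Real.sin (aperture m / 2) ^ 2) -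
      Real.sin (aperture m / 2) * (2 * Real.sin (aperture m / 2) * Real.cos (aperture m / 2)) := by
  have h := aperture_half_pos (m := m) (by omega)
  have h0 : 0 ≤ Real.cos (aperture m / 2 + 2 * (aperture m / 2)) :=
    Real.cos_nonneg_of_neg_pi_div_two_le_of_le (by linarith [Real.pi_pos])
      (by linarith [aperture_half_le hk hm])
  rw [Real.cos_add, Real.cos_two_mul', Real.sin_two_mul] at h0
  exact h0

/-- The frame of the cone that contains the directions just below the negative first axis. -/
def Frame.opposite (F : Frame m) (k : ℕ) : Frame m := (F.rot (3 * k + 1)).flip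

theorem cos_opposite (hm : m = 4 * k + 2) :
    Real.cos ((3 * k + 1 : ℕ) * aperture m) = - Real.sin (aperture m / 2) ∧
      Real.sin ((3 * k + 1 : ℕ) * aperture m) = - Real.cos (aperture m / 2) := by
  have e : (3 * k + 1 : ℕ) * aperture m = Real.pi / 2 - aperture m / 2 + Real.pi := by
    have := pi_div_two_eq hm
    have e2 : Real.pi = 2 * ((2 * k + 1) * (aperture m / 2)) := by linarith
    push_cast; linear_combination -this - e2
  rw [e, Real.cos_add_pi, Real.sin_add_pi, Real.cos_pi_div_two_sub, Real.sin_pi_div_two_sub]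
  exact ⟨rfl, rfl⟩

theorem Frame.X_opposite (F : Frame m) (hm : m = 4 * k + 2) (d : Plane) :
    (F.opposite k).X d =
      Real.sin (aperture m / 2) * F.X d - Real.cos (aperture m / 2) * F.Y d := by
  rw [Frame.opposite, Frame.X_flip, Frame.X_rot, (cos_opposite hm).1, (cos_opposite hm).2]; ring

theorem Frame.Y_opposite (F : Frame m) (hm : m = 4 * k + 2) (d : Plane) :
    (F.opposite k).Y d =
      -(Real.cos (aperture m / 2) * F.X d + Real.sin (aperture m / 2) * F.Y d) := by
  rw [Frame.opposite, Frame.Y_flip, Frame.Y_rot, (cos_opposite hm).1, (cos_opposite hm).2]; ring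

theorem exists_polar {x y : ℝ} (hx : 0 ≤ x) (hy : 0 < y) : ∃ r ψ : ℝ, 0 < r ∧ 0 ≤ ψ ∧
    ψ < Real.pi / 2 ∧ x = r * Real.sin ψ ∧ y = r * Real.cos ψ := by
  have hne : (⟨y, x⟩ : ℂ) ≠ 0 := fun h => hy.ne' (congrArg Complex.re h)
  refine ⟨‖(⟨y, x⟩ : ℂ)‖, Complex.arg ⟨y, x⟩, norm_pos_iff.mpr hne,
    Complex.arg_nonneg_iff.mpr hx, ?_, ?_, ?_⟩
  · exact (abs_lt.mp (Complex.abs_arg_lt_pi_div_two_iff.mpr (Or.inl hy))).2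
  · exact (Complex.norm_mul_sin_arg (⟨y, x⟩ : ℂ)).symm
  · exact (Complex.norm_mul_cos_arg (⟨y, x⟩ : ℂ)).symm

/-- For directions steeper than the lowest cone, the bound for the cone of the direction is at most
the bound for the upward cone. -/
theorem Frame.exists_rot (F : Frame m) (hk : 1 ≤ k) (hm : m = 4 * k + 2) {d : Plane}
    (hX : 0 ≤ F.X d) (hY : 0 < F.Y d)
    (hd : 2 * Real.sin (aperture m / 2) * Real.cos (aperture m / 2) * F.X d ≤
      (Real.cos (aperture m / 2) ^ 2 - Real.sin (aperture m / 2) ^ 2) * F.Y d) :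
    ∃ n ≤ k, (F.rot n).InCone d ∧
      |(F.rot n).X d| + (1 + Real.sin (aperture m / 2)) / Real.cos (aperture m / 2) *
        (F.rot n).Y d ≤ F.borderLength d := by
  have hm3 : 3 ≤ m := by omega
  have hh := aperture_half_pos hm3
  have hcos := cos_aperture_half_pos hm3
  have hpi := pi_div_two_eq hm
  have hle := aperture_half_le hk hm
  obtain ⟨r, ψ, hr, hψ0, hψ1, hx, hy⟩ := exists_polar hX hY
  have hap : aperture m = 2 * (aperture m / 2) := by ring
  simp only [Frame.borderLength, Frame.InCone, Frame.X_rot, Frame.Y_rot, hx, hy]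
  rw [hx, hy] at hd
  set h := aperture m / 2 with hdef
  -- The angle `ψ` is measured from the bisector; `hd` says that its cotangent is at least `tan
  -- (2h)`.
  have hψ : ψ ≤ Real.pi / 2 - 2 * h := by
    by_contra hc
    push Not at hc
    have h1 : 0 < Real.sin (2 * h - (Real.pi / 2 - ψ)) :=
      Real.sin_pos_of_pos_of_lt_pi (by linarith) (by linarith [Real.pi_pos])
    rw [Real.sin_sub, Real.sin_pi_div_two_sub, Real.cos_pi_div_two_sub, Real.sin_two_mul,
      Real.cos_two_mul'] at h1
    nlinarith
  -- The bisector nearest to `ψ`, found by rounding.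
  obtain ⟨n, hn⟩ : ∃ n : ℕ, |ψ - n * (2 * h)| ≤ h := by
    refine ⟨⌊ψ / (2 * h) + 1 / 2⌋₊, ?_⟩
    have hnn : 0 ≤ ψ / (2 * h) + 1 / 2 := by positivity
    have h1 := Nat.floor_le hnn
    have h2 := Nat.lt_floor_add_one (ψ / (2 * h) + 1 / 2)
    set N : ℝ := (⌊ψ / (2 * h) + 1 / 2⌋₊ : ℝ)
    have e : ψ = ψ / (2 * h) * (2 * h) := by field_simp
    rw [abs_le]
    constructor <;> nlinarith
  have hn' := abs_le.mp hn
  set t := |ψ - n * (2 * h)| with ht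
  have ht0 : 0 ≤ t := abs_nonneg _
  have htψ : t ≤ ψ := by
    rcases Nat.eq_zero_or_pos n with h0 | h0
    · rw [ht, h0]; simp [abs_of_nonneg hψ0]
    · have : (1 : ℝ) ≤ n := by exact_mod_cast h0
      nlinarith
  have hsin : ∀ r : ℝ, 0 < r → |r * Real.sin (ψ - n * (2 * h))| = r * Real.sin t := by
    intro r hr
    rw [abs_mul, abs_of_pos hr, Real.abs_sin_eq_sin_abs_of_abs_le_pi]
    linarith [Real.pi_pos]
  have hcost : Real.cos (ψ - n * (2 * h)) = Real.cos t := (Real.cos_abs _).symm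
  have eX : Real.cos (n * aperture m) * (r * Real.sin ψ) -
      Real.sin (n * aperture m) * (r * Real.cos ψ) = r * Real.sin (ψ - n * (2 * h)) := by
    rw [hap, Real.sin_sub]; ring
  have eY : Real.cos (n * aperture m) * (r * Real.cos ψ) +
      Real.sin (n * aperture m) * (r * Real.sin ψ) = r * Real.cos t := by
    rw [← hcost, hap, Real.cos_sub]; ring
  refine ⟨n, ?_, ?_, ?_⟩
  · have : (n : ℝ) < k + 1 := by nlinarith
    exact Nat.lt_succ_iff.mp (by exact_mod_cast this)
  · rw [eX, eY, hsin r hr]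
    have h1 : 0 ≤ Real.sin (h - t) :=
      Real.sin_nonneg_of_nonneg_of_le_pi (by linarith) (by linarith [Real.pi_pos])
    rw [Real.sin_sub] at h1
    nlinarith
  · rw [eX, eY, hsin r hr]
    have e1 : Real.sin ψ - Real.sin t = 2 * Real.sin ((ψ - t) / 2) * Real.cos ((ψ + t) / 2) :=
      Real.sin_sub_sin ψ t
    have e2 : Real.cos ψ - Real.cos t = -2 * Real.sin ((ψ + t) / 2) * Real.sin ((ψ - t) / 2) :=
      Real.cos_sub_cos ψ t
    have h1 : 0 ≤ Real.sin ((ψ - t) / 2) :=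
      Real.sin_nonneg_of_nonneg_of_le_pi (by linarith) (by linarith [Real.pi_pos])
    -- This amounts to `ψ + t + h ≤ π/2`, which follows from `ψ ≤ π/2 - 2h` and `t ≤ h`.
    have h2 : 0 ≤ Real.cos ((ψ + t) / 2 + h) - Real.sin ((ψ + t) / 2) := by
      rw [sub_nonneg, ← Real.cos_pi_div_two_sub]
      exact Real.cos_le_cos_of_nonneg_of_le_pi (by linarith) (by linarith [Real.pi_pos])
        (by linarith)
    rw [Real.cos_add] at h2
    have e3 : r * Real.sin ψ + (1 + Real.sin h) / Real.cos h * (r * Real.cos ψ) -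
        (r * Real.sin t + (1 + Real.sin h) / Real.cos h * (r * Real.cos t)) =
        r * (2 * Real.sin ((ψ - t) / 2)) * (Real.cos ((ψ + t) / 2) * Real.cos h -
          Real.sin ((ψ + t) / 2) * Real.sin h - Real.sin ((ψ + t) / 2)) / Real.cos h := by
      field_simp
      linear_combination Real.cos h * e1 + (1 + Real.sin h) * e2
    have : 0 ≤ r * (2 * Real.sin ((ψ - t) / 2)) * (Real.cos ((ψ + t) / 2) * Real.cos h -
          Real.sin ((ψ + t) / 2) * Real.sin h - Real.sin ((ψ + t) / 2)) / Real.cos h := by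
      positivity
    linarith

/-- Canonical triangles of pairs in the upper part of a canonical triangle are smaller. -/
theorem size_lt (hk : 1 ≤ k) (hm : m = 4 * k + 2) {n : ℕ} (hn : n ≤ k) {x₁ y₁ x₂ y₂ : ℝ}
    (h₁ : |x₁| * Real.cos (aperture m / 2) < Real.sin (aperture m / 2) * y₁)
    (h₂ : |x₂| * Real.cos (aperture m / 2) < Real.sin (aperture m / 2) * y₂)
    (hy₁ : 0 < y₁) (hy₂ : 0 < y₂) :
    Real.cos (n * aperture m) * (y₂ - y₁) + Real.sin (n * aperture m) * (x₂ - x₁) < y₂ := by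
  have hm3 : 3 ≤ m := by omega
  have hh := aperture_half_pos hm3
  have hcos := cos_aperture_half_pos hm3
  have hpi := pi_div_two_eq hm
  rcases Nat.eq_zero_or_pos n with h0 | h0
  · simp [h0, hy₁]
  have h1 : (1 : ℝ) ≤ n := by exact_mod_cast h0
  have h2 : (n : ℝ) ≤ k := by exact_mod_cast hn
  have hap : n * aperture m = 2 * n * (aperture m / 2) := by ring
  rw [hap]
  set h := aperture m / 2
  have hη1 : 2 * h ≤ 2 * n * h := by nlinarith
  have hη2 : 2 * n * h ≤ Real.pi / 2 - h := by rw [hpi]; nlinarith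
  have hsinη : 0 < Real.sin (2 * n * h) :=
    Real.sin_pos_of_pos_of_lt_pi (by linarith) (by linarith [Real.pi_pos])
  -- With `η = 2nh`, `hd` bounds the left side times `cos h` by `y₂ cos (η - h) - y₁ cos (η + h)`,
  -- which is at most `y₂ cos h`.
  have hA : Real.cos (2 * n * h - h) ≤ Real.cos h :=
    Real.cos_le_cos_of_nonneg_of_le_pi hh.le (by linarith [Real.pi_pos]) (by linarith)
  have hB : 0 ≤ Real.cos (2 * n * h + h) :=
    Real.cos_nonneg_of_neg_pi_div_two_le_of_le (by linarith [Real.pi_pos]) (by linarith)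
  rw [Real.cos_sub] at hA
  rw [Real.cos_add] at hB
  have hd : (x₂ - x₁) * Real.cos h < Real.sin h * (y₁ + y₂) := by
    have := mul_le_mul_of_nonneg_right (le_abs_self x₂) hcos.le
    have := mul_le_mul_of_nonneg_right (neg_le_abs x₁) hcos.le
    linarith
  refine lt_of_mul_lt_mul_right ?_ hcos.le
  have := mul_lt_mul_of_pos_left hd hsinη
  nlinarith [mul_le_mul_of_nonneg_right hA hy₂.le, mul_nonneg hB hy₁.le]

end Trigonometry

/-! ### Triangles beside a chain edge -/

/-- The lower triangle of an almost horizontal edge of the chain lies below the chain. -/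
theorem lower_triangle {s c x₁ y₁ x₂ y₂ xw yw x y : ℝ} (hs : 0 < s) (hc : 0 < c)
    (h₃ : 0 ≤ c * (c ^ 2 - s ^ 2) - s * (2 * s * c)) (hp : 0 < s * y₁ + c * x₁)
    (hw : xw * c ≤ s * yw) (hyw : 0 < yw) (hqp : 0 < x₂ * y₁ - y₂ * x₁)
    (hwq : 0 ≤ xw * y₂ - yw * x₂) (hdw : 0 < (x₂ - x₁) * yw - (y₂ - y₁) * xw)
    (hx : 0 ≤ x₂ - x₁) (hy : 0 < y₂ - y₁)
    (hd : (c ^ 2 - s ^ 2) * (y₂ - y₁) < 2 * s * c * (x₂ - x₁))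
    (h1 : 0 < (x - x₂) * (y₂ - y₁) - (y - y₂) * (x₂ - x₁))
    (h2 : 2 * s * c * (x - x₂) ≤ (c ^ 2 - s ^ 2) * (y - y₂))
    (h3 : 0 ≤ c * (x - x₁) + s * (y - y₁)) :
    0 < x * y₁ - y * x₁ ∧ 0 ≤ xw * y - yw * x := by
  constructor
  · have hΔ : 0 < (y₂ - y₁) * s + c * (x₂ - x₁) := by positivity
    -- The offset from `(x₁, y₁)` is expanded in the edge direction and the left border direction
    -- `(-s, c)`.
    have e : ((y₂ - y₁) * s + c * (x₂ - x₁)) * (x * y₁ - y * x₁) =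
        (s * y₁ + c * x₁) * ((x - x₂) * (y₂ - y₁) - (y - y₂) * (x₂ - x₁)) +
        (x₂ * y₁ - y₂ * x₁) * (c * (x - x₁) + s * (y - y₁)) := by ring
    have : 0 < ((y₂ - y₁) * s + c * (x₂ - x₁)) * (x * y₁ - y * x₁) := by
      rw [e]; exact add_pos_of_pos_of_nonneg (mul_pos hp h1) (mul_nonneg hqp.le h3)
    exact pos_of_mul_pos_right this hΔ.le
  · have hΔ : 0 < 2 * s * c * (x₂ - x₁) - (c ^ 2 - s ^ 2) * (y₂ - y₁) := by linarith
    -- Now the offset from `(x₂, y₂)` is expanded in the edge direction and `(cos θ, sin θ)`, the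
    -- reversed border of the opposite cone.
    have e : (2 * s * c * (x₂ - x₁) - (c ^ 2 - s ^ 2) * (y₂ - y₁)) *
          (xw * (y - y₂) - yw * (x - x₂)) =
        ((c ^ 2 - s ^ 2) * yw - 2 * s * c * xw) *
          ((x - x₂) * (y₂ - y₁) - (y - y₂) * (x₂ - x₁)) +
        ((x₂ - x₁) * yw - (y₂ - y₁) * xw) *
          ((c ^ 2 - s ^ 2) * (y - y₂) - 2 * s * c * (x - x₂)) := by ring
    -- The target is at most `θ/2` to the right of the bisector, and `θ/2 ≤ π/2 - θ`.
    have h4 : 0 ≤ (c ^ 2 - s ^ 2) * yw - 2 * s * c * xw := by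
      have : 0 ≤ c * ((c ^ 2 - s ^ 2) * yw - 2 * s * c * xw) := by
        nlinarith [mul_nonneg h₃ hyw.le, mul_le_mul_of_nonneg_left hw (mul_pos hs hc).le]
      exact nonneg_of_mul_nonneg_right this hc
    have h5 : 0 ≤ (2 * s * c * (x₂ - x₁) - (c ^ 2 - s ^ 2) * (y₂ - y₁)) *
          (xw * (y - y₂) - yw * (x - x₂)) := by
      rw [e]
      exact add_nonneg (mul_nonneg h4 h1.le) (mul_nonneg hdw.le (by linarith))
    have h6 := nonneg_of_mul_nonneg_right h5 hΔ
    nlinarith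

/-- Points of the right triangle of an edge of the chain that leans to the left. -/
theorem right_triangle {s c x₁ y₁ x₂ y₂ x y : ℝ} (hs : 0 < s) (hc : 0 < c)
    (hp : x₁ * c < s * y₁) (hqp : 0 < x₂ * y₁ - y₂ * x₁) (hx : x₂ - x₁ < 0) (hy : 0 < y₂ - y₁)
    (h1 : 0 < (x - x₁) * (y₂ - y₁) - (y - y₁) * (x₂ - x₁))
    (h2 : (x - x₁) * c ≤ s * (y - y₁)) : 0 < x * y₁ - y * x₁ := by
  have hΔ : 0 < (y₂ - y₁) * s - c * (x₂ - x₁) := by nlinarith [mul_pos hy hs]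
  -- The offset from `(x₁, y₁)` in the basis of the edge and the right border `(s, c)`.
  have e : ((y₂ - y₁) * s - c * (x₂ - x₁)) * (x * y₁ - y * x₁) =
      (s * y₁ - x₁ * c) * ((x - x₁) * (y₂ - y₁) - (y - y₁) * (x₂ - x₁)) +
      (x₂ * y₁ - y₂ * x₁) * (s * (y - y₁) - (x - x₁) * c) := by ring
  have : 0 < ((y₂ - y₁) * s - c * (x₂ - x₁)) * (x * y₁ - y * x₁) := by
    rw [e]
    exact add_pos_of_pos_of_nonneg (mul_pos (by linarith) h1) (mul_nonneg hqp.le (by linarith))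
  exact pos_of_mul_pos_right this hΔ.le

/-! ### Walk lengths and the induction statement -/

variable {k m : ℕ} {P : Finset Plane} {S : SimpleGraph P}

/-- The constrained theta-graph contains a walk from `p` to `q` of length at most `D`. -/
def Reach (S : SimpleGraph P) (m : ℕ) (p q : P) (D : ℝ) : Prop :=
  ∃ W : (constrainedThetaGraph S m).Walk p q, walkLength W ≤ D

theorem walkLength_append {G : SimpleGraph P} {p q r : P} (A : G.Walk p q) (B : G.Walk q r) :
    walkLength (A.append B) = walkLength A + walkLength B := by
  simp [walkLength]

theorem walkLength_nonneg {G : SimpleGraph P} {p q : P} (A : G.Walk p q) : 0 ≤ walkLength A :=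
  List.sum_nonneg (by
    intro x hx
    obtain ⟨e, _, rfl⟩ := List.mem_map.mp hx
    exact dist_nonneg)

theorem walkLength_reverse {G : SimpleGraph P} {p q : P} (A : G.Walk p q) :
    walkLength A.reverse = walkLength A := by
  simp [walkLength, Function.comp_def, dist_comm]

theorem walkLength_bypass_le [DecidableEq P] {G : SimpleGraph P} {p q : P} (A : G.Walk p q) :
    walkLength A.bypass ≤ walkLength A := by
  induction A with
  | nil => simp [SimpleGraph.Walk.bypass]
  | @cons p r q h A ih =>
    have e : walkLength (SimpleGraph.Walk.cons h A) = dist (p : Plane) r + walkLength A := by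
      simp [walkLength]
    rw [e, SimpleGraph.Walk.bypass]
    split_ifs with hs
    · have h1 := walkLength_append (A.bypass.takeUntil p hs) (A.bypass.dropUntil p hs)
      rw [SimpleGraph.Walk.take_spec] at h1
      have := walkLength_nonneg (A.bypass.takeUntil p hs)
      have := dist_nonneg (x := (p : Plane)) (y := r)
      linarith
    · have e' : walkLength (SimpleGraph.Walk.cons h A.bypass) =
          dist (p : Plane) r + walkLength A.bypass := by
        simp [walkLength]
      linarith

theorem Reach.trans {p q r : P} {D E : ℝ} (h₁ : Reach S m p q D) (h₂ : Reach S m q r E) :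
    Reach S m p r (D + E) := by
  obtain ⟨A, hA⟩ := h₁
  obtain ⟨B, hB⟩ := h₂
  exact ⟨A.append B, by rw [walkLength_append]; linarith⟩

theorem Reach.symm {p q : P} {D : ℝ} (h : Reach S m p q D) : Reach S m q p D := by
  obtain ⟨A, hA⟩ := h
  exact ⟨A.reverse, by rwa [walkLength_reverse]⟩

theorem Reach.mono {p q : P} {D E : ℝ} (h : Reach S m p q D) (hDE : D ≤ E) : Reach S m p q E := by
  obtain ⟨A, hA⟩ := h
  exact ⟨A, hA.trans hDE⟩

theorem AddsEdge.reach {p q : P} (h : AddsEdge S m p q) : Reach S m p q ‖(q : Plane) - p‖ := by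
  have hadj : (constrainedThetaGraph S m).Adj p q := Or.inl h
  refine ⟨hadj.toWalk, le_of_eq ?_⟩
  simp [walkLength, dist_eq_norm', SimpleGraph.Adj.toWalk]

/-- No vertex lies in the part of the canonical triangle of `u` and `w` to the right of `uw`. -/
def RightEmpty (F : Frame m) (u w : P) : Prop :=
  ∀ z : P, ¬ (0 < turn F.σ ((z : Plane) - u) (w - u) ∧
    F.X ((z : Plane) - u) * Real.cos (aperture m / 2) ≤
      Real.sin (aperture m / 2) * F.Y ((z : Plane) - u) ∧
    F.Y ((z : Plane) - u) ≤ F.Y ((w : Plane) - u))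

/-- The two bounds for a pair of vertices that are proved by induction on the size of its canonical
triangle. -/
def PairBound (S : SimpleGraph P) (F : Frame m) (u w : P) : Prop :=
  Reach S m u w (|F.X ((w : Plane) - u)| +
      (1 + Real.sin (aperture m / 2)) / Real.cos (aperture m / 2) * F.Y ((w : Plane) - u)) ∧
    (RightEmpty F u w → Reach S m u w (F.borderLength ((w : Plane) - u)))

/-- The bounds hold for all visible pairs with a canonical triangle of height less than `H`. -/
def BoundsBelow (S : SimpleGraph P) (m : ℕ) (H : ℝ) : Prop :=
  ∀ (G : Frame m) (p q : P), p ≠ q → CanSee S p q → G.InCone ((q : Plane) - p) →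
    G.Y ((q : Plane) - p) < H → PairBound S G p q

/-- The part of the convex chain from `p` to `w` is still to be built. -/
structure ChainState (S : SimpleGraph P) (F : Frame m) (u w p : P) : Prop where
  pos : 0 < turn F.σ ((w : Plane) - u) (p - u)
  see : CanSee S u p
  cone : F.InCone ((p : Plane) - u)
  free : ∀ z : P, S.Adj u z →
    ¬ (0 < turn F.σ ((z : Plane) - u) (p - u) ∧ 0 < turn F.σ ((w : Plane) - u) (z - u))
  low : ∀ z : P, z ≠ u → CanSee S u z → Wedge F.σ (u : Plane) p w z →
    F.Y ((p : Plane) - u) ≤ F.Y ((z : Plane) - u)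

/-- The vertex `q` follows `p` in the convex chain to `w` in the wedge with apex `u`. -/
structure Link (S : SimpleGraph P) (F : Frame m) (u w p q : P) : Prop where
  ne_apex : q ≠ u
  ne : q ≠ p
  wedge : Wedge F.σ (u : Plane) p w q
  see : CanSee S p q
  see_apex : CanSee S u q
  pos : 0 < turn F.σ ((q : Plane) - u) (p - u)
  hull : ∀ z : P, z ≠ u → z ≠ p → Wedge F.σ (u : Plane) p w z →
    0 ≤ turn F.σ ((q : Plane) - p) (z - p)

/-- The three-term Plücker relation; it yields transitivity of the angular order around `u`. -/
theorem turn_plucker (σ : ℝ) (u p q w z : Plane) :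
    turn σ (w - u) (q - u) * turn σ (z - u) (p - u) =
      turn σ (w - u) (z - u) * turn σ (q - u) (p - u) +
        turn σ (z - u) (q - u) * turn σ (w - u) (p - u) := by
  simp only [turn, cross]; ring

/-! ### The convex chain and its edges -/

section Chain

variable {F : Frame m} {u w p q : P}

theorem ChainState.ne_apex (h : ChainState S F u w p) : u ≠ p := by
  rintro rfl
  have := h.pos
  simp [turn, cross] at this

theorem ChainState.target_ne_apex (h : ChainState S F u w p) : u ≠ w := by
  rintro rfl
  have := h.pos
  simp [turn, cross] at this

theorem ChainState.target_ne (h : ChainState S F u w p) : w ≠ p := by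
  rintro rfl
  have := h.pos
  rw [turn_self] at this
  exact this.false

theorem ChainState.target_wedge (h : ChainState S F u w p) : Wedge F.σ (u : Plane) p w w :=
  ⟨h.pos.le, by rw [turn_self]⟩

theorem ChainState.exists_link (hP : GeneralPosition m P) (hS : PlanarConstraints S)
    (h : ChainState S F u w p) (hw : CanSee S u w) : ∃ q, Link S F u w p q := by
  obtain ⟨q, h1, h2, h3, h4, h5, h6, h7⟩ :=
    exists_next hP hS F.sigma_ne_zero h.pos h.see hw h.free
  exact ⟨q, h1, h2, h3, h4, h5, h6, h7⟩

theorem Link.cone (hm : 3 ≤ m) (h : ChainState S F u w p) (hq : Link S F u w p q)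
    (hw : F.InCone ((w : Plane) - u)) : F.InCone ((q : Plane) - u) := by
  obtain ⟨a, b, ha, hb, e⟩ := hq.wedge.exists_combination h.pos
  rw [e]
  exact h.cone.combination (cos_aperture_half_pos hm).le hw ha hb

theorem Link.turn_pos (hP : GeneralPosition m P) (h : ChainState S F u w p)
    (hq : Link S F u w p q) (hqw : q ≠ w) : 0 < turn F.σ ((w : Plane) - u) (q - u) :=
  lt_of_le_of_ne hq.wedge.2
    (hP.turn_ne_zero F.sigma_ne_zero h.target_ne_apex hq.ne_apex.symm hqw.symm).symm

theorem Link.wedge_of_wedge (hP : GeneralPosition m P) (h : ChainState S F u w p)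
    (hq : Link S F u w p q) (hqw : q ≠ w) {z : Plane} (hz : Wedge F.σ (u : Plane) q w z) :
    Wedge F.σ (u : Plane) p w z := by
  have h1 := hq.turn_pos hP h hqw
  refine ⟨?_, hz.2⟩
  have h2 := turn_plucker F.σ u p q w z
  have h3 : 0 ≤ turn F.σ ((w : Plane) - u) (q - u) * turn F.σ (z - u) (p - u) := by
    rw [h2]
    exact add_nonneg (mul_nonneg hz.2 hq.pos.le) (mul_nonneg hz.1 h.pos.le)
  exact nonneg_of_mul_nonneg_right h3 h1

theorem Link.not_wedge (hq : Link S F u w p q) : ¬ Wedge F.σ (u : Plane) q w p := by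
  intro h
  have h1 := h.1
  rw [turn_swap] at h1
  linarith [hq.pos]

theorem Link.exists_combination (hq : Link S F u w p q) {z : P} (hzu : z ≠ u)
    (hz : Wedge F.σ (u : Plane) p w z) :
    ∃ a b : ℝ, 0 ≤ a ∧ 0 ≤ b ∧ (z : Plane) - p = a • ((q : Plane) - p) + b • ((p : Plane) - u) := by
  by_cases hzp : z = p
  · exact ⟨0, 0, le_rfl, le_rfl, by simp [hzp]⟩
  have e1 : turn F.σ ((q : Plane) - p) (p - u) = turn F.σ ((q : Plane) - u) (p - u) := by
    simp only [turn, cross, PiLp.sub_apply]; ring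
  have e2 : turn F.σ ((z : Plane) - p) (p - u) = turn F.σ ((z : Plane) - u) (p - u) := by
    simp only [turn, cross, PiLp.sub_apply]; ring
  have hΔ : 0 < turn F.σ ((q : Plane) - p) (p - u) := by rw [e1]; exact hq.pos
  refine ⟨_, _, div_nonneg ?_ hΔ.le, div_nonneg ?_ hΔ.le,
    (eq_combination hΔ.ne' ((z : Plane) - p)).trans (add_comm _ _)⟩
  · rw [e2]; exact hz.1
  · exact hq.hull z hzu hzp hz

/-- Convexity of the chain: past `q`, vertices lie beyond both the line `pq` and the ray `uq`.
Monotonicity of `Y` or `X` along an edge thus passes to the rest of the chain. -/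
theorem Link.exists_combination_next (hP : GeneralPosition m P) (h : ChainState S F u w p)
    (hq : Link S F u w p q) (hqw : q ≠ w) {z : P} (hzu : z ≠ u)
    (hz : Wedge F.σ (u : Plane) q w z) :
    ∃ a b : ℝ, 0 ≤ a ∧ 0 ≤ b ∧ (z : Plane) - q = a • ((q : Plane) - p) + b • ((q : Plane) - u) := by
  have hzp : z ≠ p := by rintro rfl; exact hq.not_wedge hz
  have e1 : turn F.σ ((q : Plane) - p) (q - u) = turn F.σ ((q : Plane) - u) (p - u) := by
    simp only [turn, cross, PiLp.sub_apply]; ring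
  have e2 : turn F.σ ((z : Plane) - q) (q - u) = turn F.σ ((z : Plane) - u) (q - u) := by
    simp only [turn, cross, PiLp.sub_apply]; ring
  have e3 : turn F.σ ((q : Plane) - p) (z - q) = turn F.σ ((q : Plane) - p) (z - p) := by
    simp only [turn, cross, PiLp.sub_apply]; ring
  have hΔ : 0 < turn F.σ ((q : Plane) - p) (q - u) := by rw [e1]; exact hq.pos
  refine ⟨_, _, div_nonneg ?_ hΔ.le, div_nonneg ?_ hΔ.le,
    (eq_combination hΔ.ne' ((z : Plane) - q)).trans (add_comm _ _)⟩
  · rw [e2]; exact hz.1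
  · rw [e3]; exact hq.hull z hzu hzp (hq.wedge_of_wedge hP h hqw hz)

theorem Link.Y_lt (hm : 3 ≤ m) (hP : GeneralPosition m P) (h : ChainState S F u w p)
    (hq : Link S F u w p q) : 0 < F.Y ((q : Plane) - p) := by
  have h1 := h.low q hq.ne_apex hq.see_apex hq.wedge
  have h2 : F.Y ((q : Plane) - p) ≠ 0 := F.Y_ne_zero (by omega) hP hq.ne.symm
  have e : F.Y ((q : Plane) - p) = F.Y ((q : Plane) - u) - F.Y ((p : Plane) - u) := by
    simp only [F.Y_sub]; ring
  exact lt_of_le_of_ne (by linarith) h2.symm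

theorem Link.chainState (hm : 3 ≤ m) (hP : GeneralPosition m P) (h : ChainState S F u w p)
    (hw : F.InCone ((w : Plane) - u))
    (hq : Link S F u w p q) (hqw : q ≠ w) : ChainState S F u w q where
  pos := hq.turn_pos hP h hqw
  see := hq.see_apex
  cone := hq.cone hm h hw
  free z hz hzz := by
    have h1 := hq.turn_pos hP h hqw
    have h2 := turn_plucker F.σ u p q w z
    refine h.free z hz ⟨?_, hzz.2⟩
    have h3 : 0 < turn F.σ ((w : Plane) - u) (q - u) * turn F.σ ((z : Plane) - u) (p - u) := by
      rw [h2]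
      exact add_pos (mul_pos hzz.2 hq.pos) (mul_pos hzz.1 h.pos)
    exact pos_of_mul_pos_right h3 h1.le
  low z hzu hz hzW := by
    obtain ⟨a, b, ha, hb, e⟩ := hq.exists_combination_next hP h hqw hzu hzW
    have h1 := hq.Y_lt hm hP h
    have h2 := (hq.cone hm h hw).Y_pos hm hP hq.ne_apex.symm
    have h3 : F.Y ((z : Plane) - q) = F.Y ((z : Plane) - u) - F.Y ((q : Plane) - u) := by
      simp only [F.Y_sub]; ring
    rw [e, F.Y_add, F.Y_smul, F.Y_smul] at h3
    nlinarith [mul_nonneg ha h1.le, mul_nonneg hb h2.le]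

set_option maxHeartbeats 1000000 in
/-- The bounds for one edge of the convex chain. -/
theorem Link.reach (hk : 1 ≤ k) (hm : m = 4 * k + 2) (hP : GeneralPosition m P)
    (hw : F.InCone ((w : Plane) - u)) (hsee : CanSee S u w)
    (hIH : BoundsBelow S m (F.Y ((w : Plane) - u)))
    (h : ChainState S F u w p) (hq : Link S F u w p q) :
    (0 ≤ F.X ((q : Plane) - p) → Reach S m p q (F.borderLength ((q : Plane) - p))) ∧
    (F.X ((q : Plane) - p) < 0 → Reach S m p q (F.flip.borderLength ((q : Plane) - p))) ∧
    (F.X ((q : Plane) - p) < 0 → RightEmpty F u w →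
      Reach S m p q (F.borderLength ((q : Plane) - p))) := by
  have hm3 : 3 ≤ m := by omega
  have hcos := cos_aperture_half_pos hm3
  have hsin := sin_aperture_half_pos hm3
  have hsc := Real.sin_sq_add_cos_sq (aperture m / 2)
  have hup := h.ne_apex
  have huw := h.target_ne_apex
  have hqc := hq.cone hm3 h hw
  have hYd := hq.Y_lt hm3 hP h
  have hp1 := h.cone.lt hm3 hP hup
  have hp2 := h.cone.Y_pos hm3 hP hup
  have hq1 := hqc.lt hm3 hP hq.ne_apex.symm
  have hq2 := hqc.Y_pos hm3 hP hq.ne_apex.symm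
  have hw1 := hw.lt hm3 hP huw
  have hw2 := hw.Y_pos hm3 hP huw
  have hqw : F.Y ((q : Plane) - u) ≤ F.Y ((w : Plane) - u) := by
    by_cases hqw : q = w
    · rw [hqw]
    · have h' := hq.chainState hm3 hP h hw hqw
      exact h'.low w huw.symm hsee h'.target_wedge
  have hqp := hq.pos
  have hwq := hq.wedge.2
  have hpl := hq.hull w huw.symm h.target_ne h.target_wedge
  have eX : ∀ a b c : Plane, F.X (a - b) = F.X (a - c) - F.X (b - c) := fun a b c => by
    simp only [F.X_sub]; ring
  have eY : ∀ a b c : Plane, F.Y (a - b) = F.Y (a - c) - F.Y (b - c) := fun a b c => by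
    simp only [F.Y_sub]; ring
  have hempty : ∀ z : P, 0 < turn F.σ ((z : Plane) - u) (p - u) →
      0 ≤ turn F.σ ((w : Plane) - u) (z - u) → turn F.σ ((q : Plane) - p) (z - p) < 0 → False := by
    intro z h1 h2 h3
    have hzu : z ≠ u := by rintro rfl; simp [turn, cross] at h1
    have hzp : z ≠ p := by rintro rfl; rw [turn_self] at h1; exact h1.false
    exact absurd h3 (hq.hull z hzu hzp ⟨h1.le, h2⟩).not_gt
  have hflipX : ∀ x y : Plane, F.X (x - y) = - F.X (y - x) := fun x y => by
    simp only [F.X_sub]; ring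
  have hflipY : ∀ x y : Plane, F.Y (x - y) = - F.Y (y - x) := fun x y => by
    simp only [F.Y_sub]; ring
  rw [F.turn_eq] at hqp hwq hpl
  rw [eX q p u] at *
  rw [eY q p u] at *
  rw [eX w p u, eY w p u] at hpl
  set x₁ := F.X ((p : Plane) - u)
  set y₁ := F.Y ((p : Plane) - u)
  set x₂ := F.X ((q : Plane) - u)
  set y₂ := F.Y ((q : Plane) - u)
  set xw := F.X ((w : Plane) - u)
  set yw := F.Y ((w : Plane) - u)
  set s := Real.sin (aperture m / 2)
  set c := Real.cos (aperture m / 2)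
  -- The edge points to the right of the direction of `uw`; hence an edge leaning left still lies in
  -- the cone.
  have hdw : 0 < (x₂ - x₁) * yw - (y₂ - y₁) * xw := by nlinarith
  have hp3 : 0 < s * y₁ + c * x₁ := by
    have := mul_le_mul_of_nonneg_right (neg_le_abs x₁) hcos.le
    linarith
  have hp4 : x₁ * c < s * y₁ := (mul_le_mul_of_nonneg_right (le_abs_self x₁) hcos.le).trans_lt hp1
  have hw3 : xw * c ≤ s * yw :=
    ((mul_le_mul_of_nonneg_right (le_abs_self xw) hcos.le).trans_lt hw1).le
  have hw4 : 0 < s * yw + c * xw := by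
    have := mul_le_mul_of_nonneg_right (neg_le_abs xw) hcos.le
    linarith
  have hbl : F.borderLength ((q : Plane) - p) = (x₂ - x₁) + (1 + s) / c * (y₂ - y₁) := by
    rw [Frame.borderLength, eX q p u, eY q p u]
  have left : x₂ - x₁ < 0 → PairBound S F p q := by
    intro hx
    refine hIH F p q hq.ne.symm hq.see ?_ ?_
    · unfold Frame.InCone
      rw [eX q p u, eY q p u]
      change |x₂ - x₁| * c ≤ s * (y₂ - y₁)
      rw [abs_of_neg hx]
      have h1 : 0 ≤ yw * (s * (y₂ - y₁) + c * (x₂ - x₁)) := by nlinarith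
      have := nonneg_of_mul_nonneg_right h1 hw2
      linarith
    · rw [eY q p u]
      change y₂ - y₁ < yw
      linarith
  refine ⟨fun hx => ?_, fun hx => ?_, fun hx hR => ?_⟩
  · rcases lt_or_ge ((c ^ 2 - s ^ 2) * (y₂ - y₁)) (2 * s * c * (x₂ - x₁)) with hd | hd
    · have hs2 : s ≤ 1 / 2 := sin_aperture_half_le hk hm
      -- The edge is bounded from `q`. The left border of this cone is perpendicular to the bisector
      -- of `F`, and the side opposite `q` is parallel to the left border of `F`: the two border
      -- paths coincide.
      set G := F.opposite k with hG
      have gX : G.X ((p : Plane) - q) = -(s * (x₂ - x₁) - c * (y₂ - y₁)) := by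
        rw [hG, F.X_opposite hm, hflipX, hflipY, eX q p u, eY q p u]; ring
      have gY : G.Y ((p : Plane) - q) = c * (x₂ - x₁) + s * (y₂ - y₁) := by
        rw [hG, F.Y_opposite hm, hflipX, hflipY, eX q p u, eY q p u]; ring
      have hB := hIH G q p hq.ne hq.see.symm ?_ ?_
      · refine ((hB.2 ?_).symm).mono (le_of_eq ?_)
        -- To the right of `qp` in `G` means below the edge in `F`.
        · rintro z ⟨h1, h2, h3⟩
          have gs : (G.σ : ℝ) = -F.σ := by
            simp [hG, Frame.opposite, Frame.flip, Frame.rot]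
          have gt : turn G.σ ((z : Plane) - q) (p - q) = turn F.σ ((z : Plane) - q) (q - p) := by
            rw [gs]; simp only [turn, cross, PiLp.sub_apply]; ring
          rw [gt, F.turn_eq, eX z q u, eY z q u, eX q p u, eY q p u] at h1
          rw [gY, hG, F.Y_opposite hm, eX z q u, eY z q u] at h3
          rw [hG, F.Y_opposite hm, F.X_opposite hm, eX z q u, eY z q u] at h2
          have key := lower_triangle (s := s) (c := c) (x₁ := x₁) (y₁ := y₁) (x₂ := x₂) (y₂ := y₂)
            (xw := xw) (yw := yw) (x := F.X ((z : Plane) - u)) (y := F.Y ((z : Plane) - u))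
            hsin hcos (cos_three_aperture_half hk hm) hp3 hw3 hw2 hqp (by linarith) hdw hx hYd hd
            (by linarith) (by
              change (s * (F.X ((z : Plane) - u) - x₂) - c * (F.Y ((z : Plane) - u) - y₂)) * c ≤
                s * -(c * (F.X ((z : Plane) - u) - x₂) + s * (F.Y ((z : Plane) - u) - y₂)) at h2
              nlinarith)
            (by
              change -(c * (F.X ((z : Plane) - u) - x₂) + s * (F.Y ((z : Plane) - u) - y₂)) ≤
                _ at h3
              nlinarith)
          refine hempty z ?_ ?_ ?_
          · rw [F.turn_eq]; exact key.1
          · rw [F.turn_eq]; exact key.2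
          · rw [F.turn_eq, eX q p u, eY q p u, eX z p u, eY z p u]
            change 0 < (F.X ((z : Plane) - u) - x₂) * (y₂ - y₁) -
              (F.Y ((z : Plane) - u) - y₂) * (x₂ - x₁) at h1
            change (x₂ - x₁) * (F.Y ((z : Plane) - u) - y₁) -
              (y₂ - y₁) * (F.X ((z : Plane) - u) - x₁) < 0
            nlinarith
        · rw [hbl, Frame.borderLength, gX, gY]
          change -(s * (x₂ - x₁) - c * (y₂ - y₁)) +
            (1 + s) / c * (c * (x₂ - x₁) + s * (y₂ - y₁)) = _
          field_simp
          linear_combination (y₂ - y₁) * hsc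
      · unfold Frame.InCone
        rw [gX, gY]
        have h1 : |-(s * (x₂ - x₁) - c * (y₂ - y₁))| ≤ s * (c * (x₂ - x₁) + s * (y₂ - y₁)) / c := by
          rw [abs_le]
          constructor
          · rw [← neg_div, div_le_iff₀ hcos]; nlinarith [mul_pos hsin hcos]
          · rw [le_div_iff₀ hcos]; nlinarith
        rwa [le_div_iff₀ hcos] at h1
      -- The height is less than `2 s y₂`, and `s ≤ 1/2`.
      · rw [gY]
        have := mul_le_mul_of_nonneg_right (le_abs_self x₂) hcos.le
        nlinarith
    · obtain ⟨n, hn, hin, hle⟩ := F.exists_rot hk hm (d := (q : Plane) - p)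
        (by rw [eX q p u]; exact hx) (by rw [eY q p u]; exact hYd)
        (by rw [eX q p u, eY q p u]; exact hd)
      refine (hIH (F.rot n) p q hq.ne.symm hq.see hin ?_).1.mono hle
      rw [F.Y_rot, eX q p u, eY q p u]
      exact (size_lt hk hm hn hp1 hq1 hp2 hq2).trans_le hqw
  · refine (left hx).1.mono (le_of_eq ?_)
    rw [Frame.borderLength, F.X_flip, F.Y_flip, eX q p u]
    change |x₂ - x₁| + _ = -(x₂ - x₁) + _
    rw [abs_of_neg hx]
  · refine (left hx).2 ?_
    rintro z ⟨h1, h2, h3⟩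
    rw [F.turn_eq, eX z p u, eY z p u, eX q p u, eY q p u] at h1
    rw [eX z p u, eY z p u] at h2
    rw [eY z p u, eY q p u] at h3
    have key := right_triangle (s := s) (c := c) (x₁ := x₁) (y₁ := y₁) (x₂ := x₂) (y₂ := y₂)
      (x := F.X ((z : Plane) - u)) (y := F.Y ((z : Plane) - u)) hsin hcos hp4 hqp hx hYd
      (by linarith) h2
    change F.Y ((z : Plane) - u) - y₁ ≤ y₂ - y₁ at h3
    change (F.X ((z : Plane) - u) - x₁) * c ≤ s * (F.Y ((z : Plane) - u) - y₁) at h2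
    -- Such a vertex is either in the wedge below the chain, against extremality, or to the right of
    -- `uw`, against `hR`.
    rcases le_or_gt 0 (turn F.σ ((w : Plane) - u) (z - u)) with hz | hz
    · refine hempty z (by rw [F.turn_eq]; exact key) hz ?_
      rw [F.turn_eq, eX q p u, eY q p u, eX z p u, eY z p u]
      linarith
    · refine hR z ⟨by rw [turn_swap]; linarith, ?_, ?_⟩
      · change F.X ((z : Plane) - u) * c ≤ s * F.Y ((z : Plane) - u)
        linarith
      · change F.Y ((z : Plane) - u) ≤ yw
        linarith

end Chain

/-! ### Paths along the whole chain -/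

section Chain

variable {F : Frame m} {u w p q : P}

/-- The wedge shrinks along the chain and loses `p`; this is the measure that ends the chain. -/
theorem Link.card_lt (hP : GeneralPosition m P) (h : ChainState S F u w p)
    (hq : Link S F u w p q) (hqw : q ≠ w) :
    {z : P | Wedge F.σ (u : Plane) q w z}.ncard < {z : P | Wedge F.σ (u : Plane) p w z}.ncard := by
  refine Set.ncard_lt_ncard ⟨fun z hz => hq.wedge_of_wedge hP h hqw hz, fun hc => ?_⟩
    (Set.toFinite _)
  exact hq.not_wedge (hc (⟨by rw [turn_self], h.pos.le⟩ : Wedge F.σ (u : Plane) p w p))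

/-- Induction along the convex chain to `w`. -/
theorem ChainState.induction (hm : 3 ≤ m) (hP : GeneralPosition m P) (hS : PlanarConstraints S)
    (hw : F.InCone ((w : Plane) - u)) (hsee : CanSee S u w) {motive : P → Prop}
    (step : ∀ p q, ChainState S F u w p → Link S F u w p q →
      (q ≠ w → ChainState S F u w q ∧ motive q) → motive p)
    (h : ChainState S F u w p) : motive p := by
  induction hn : {z : P | Wedge F.σ (u : Plane) p w z}.ncard using Nat.strong_induction_on
    generalizing p with
  | _ n ih =>
    obtain ⟨q, hq⟩ := h.exists_link hP hS hsee
    refine step p q h hq fun hqw => ?_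
    have hs := hq.chainState hm hP h hw hqw
    exact ⟨hs, ih _ (hn ▸ hq.card_lt hP h hqw) hs rfl⟩

theorem ChainState.X_neg (hm : 3 ≤ m) (hP : GeneralPosition m P) (h : ChainState S F u w p)
    (hw : F.InCone ((w : Plane) - u)) (hX : F.X ((w : Plane) - u) < 0) :
    F.X ((p : Plane) - u) < 0 := by
  have h1 := h.pos
  rw [F.turn_eq] at h1
  have h2 := h.cone.Y_pos hm hP h.ne_apex
  have h3 := hw.Y_pos hm hP h.target_ne_apex
  by_contra hc
  push Not at hc
  nlinarith [mul_neg_of_neg_of_pos hX h2, mul_nonneg h3.le hc]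

/-- If the chain does not lean to the left, or if the right part of the canonical triangle is empty,
then all its edges are bounded by the left border. -/
theorem ChainState.reach_left (hk : 1 ≤ k) (hm : m = 4 * k + 2) (hP : GeneralPosition m P)
    (hS : PlanarConstraints S) (hw : F.InCone ((w : Plane) - u)) (hsee : CanSee S u w)
    (hIH : BoundsBelow S m (F.Y ((w : Plane) - u)))
    (hX : 0 ≤ F.X ((w : Plane) - u) ∨ RightEmpty F u w) (h : ChainState S F u w p) :
    Reach S m p w (F.borderLength ((w : Plane) - p)) := by
  have hm3 : 3 ≤ m := by omega
  refine h.induction (motive := fun p => Reach S m p w (F.borderLength ((w : Plane) - p))) hm3 hP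
    hS hw hsee fun p q h hq ih => ?_
  have hr := hq.reach hk hm hP hw hsee hIH h
  have h1 : Reach S m p q (F.borderLength ((q : Plane) - p)) := by
    rcases le_or_gt 0 (F.X ((q : Plane) - p)) with hx | hx
    · exact hr.1 hx
    · refine hr.2.2 hx (hX.resolve_left fun hX => ?_)
      have h1 := hq.hull w h.target_ne_apex.symm h.target_ne h.target_wedge
      have h2 := hq.pos
      have h3 := hw.Y_pos hm3 hP h.target_ne_apex
      have h4 := hq.Y_lt hm3 hP h
      have h5 : turn F.σ ((q : Plane) - p) (w - u) =
          turn F.σ ((q : Plane) - p) (w - p) + turn F.σ ((q : Plane) - u) (p - u) := by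
        simp only [turn, cross, PiLp.sub_apply]; ring
      rw [F.turn_eq] at h5
      nlinarith [mul_neg_of_neg_of_pos hx h3, mul_nonneg h4.le hX]
  by_cases hqw : q = w
  · subst hqw; exact h1
  · refine (h1.trans (ih hqw).2).mono (le_of_eq ?_)
    simp only [Frame.borderLength_sub]; ring

/-- The final stretch of a chain: by convexity, once it stops leaning right it never does so again,
so the right border bounds every later edge. -/
theorem ChainState.reach_right (hk : 1 ≤ k) (hm : m = 4 * k + 2) (hP : GeneralPosition m P)
    (hS : PlanarConstraints S) (hw : F.InCone ((w : Plane) - u)) (hsee : CanSee S u w)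
    (hIH : BoundsBelow S m (F.Y ((w : Plane) - u)))
    (hX : F.X ((w : Plane) - u) < 0) (h : ChainState S F u w p)
    (hmono : ∀ z : P, z ≠ u → Wedge F.σ (u : Plane) p w z →
      F.X ((z : Plane) - u) ≤ F.X ((p : Plane) - u)) :
    Reach S m p w (F.flip.borderLength ((w : Plane) - p)) := by
  have hm3 : 3 ≤ m := by omega
  revert hmono
  refine h.induction (motive := fun p => (∀ z : P, z ≠ u → Wedge F.σ (u : Plane) p w z →
      F.X ((z : Plane) - u) ≤ F.X ((p : Plane) - u)) →
      Reach S m p w (F.flip.borderLength ((w : Plane) - p))) hm3 hP hS hw hsee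
    fun p q h hq ih hmono => ?_
  have hr := hq.reach hk hm hP hw hsee hIH h
  have hqp : F.X ((q : Plane) - p) ≤ 0 := by
    have := hmono q hq.ne_apex hq.wedge
    simp only [F.X_sub] at this ⊢
    linarith
  have h1 : Reach S m p q (F.flip.borderLength ((q : Plane) - p)) := by
    rcases hqp.lt_or_eq with hx | hx
    · exact hr.2.1 hx
    · refine (hr.1 hx.ge).mono (le_of_eq ?_)
      simp only [Frame.borderLength, F.X_flip, F.Y_flip, hx, neg_zero]
  by_cases hqw : q = w
  · subst hqw; exact h1
  · obtain ⟨hs, ih⟩ := ih hqw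
    refine (h1.trans (ih fun z hzu hz => ?_)).mono (le_of_eq ?_)
    · obtain ⟨a, b, ha, hb, e⟩ := hq.exists_combination_next hP h hqw hzu hz
      have e' := congrArg F.X e
      rw [F.X_add, F.X_smul, F.X_smul] at e'
      have h2 := hs.X_neg hm3 hP hw hX
      have h3 : F.X ((z : Plane) - q) = F.X ((z : Plane) - u) - F.X ((q : Plane) - u) := by
        simp only [F.X_sub]; ring
      nlinarith [mul_nonneg ha (neg_nonneg.mpr hqp), mul_nonneg hb (neg_nonneg.mpr h2.le)]
    · simp only [Frame.borderLength_sub]; ring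

/-- If the target lies to the left of the bisector, then the path along the chain is at most as long
as the path along the right border. -/
theorem ChainState.reach_mixed (hk : 1 ≤ k) (hm : m = 4 * k + 2) (hP : GeneralPosition m P)
    (hS : PlanarConstraints S) (hw : F.InCone ((w : Plane) - u)) (hsee : CanSee S u w)
    (hIH : BoundsBelow S m (F.Y ((w : Plane) - u)))
    (hX : F.X ((w : Plane) - u) < 0) (h : ChainState S F u w p) :
    Reach S m p w
      (F.flip.borderLength ((w : Plane) - u) - F.borderLength ((p : Plane) - u)) := by
  have hm3 : 3 ≤ m := by omega
  refine h.induction (motive := fun p => Reach S m p w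
      (F.flip.borderLength ((w : Plane) - u) - F.borderLength ((p : Plane) - u))) hm3 hP hS hw hsee
    fun p q h hq ih => ?_
  have hr := hq.reach hk hm hP hw hsee hIH h
  rcases le_or_gt 0 (F.X ((q : Plane) - p)) with hx | hx
  · have h1 := hr.1 hx
    by_cases hqw : q = w
    · subst hqw
      refine h1.mono ?_
      simp only [Frame.borderLength, F.X_flip, F.Y_flip, F.X_sub, F.Y_sub] at hX ⊢
      linarith
    · refine (h1.trans (ih hqw).2).mono (le_of_eq ?_)
      simp only [Frame.borderLength_sub]; ring
  -- At the turning vertex `p` the border changes. The sum of the left border to `p` and the right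
  -- border onwards differs from the claim by `2 X (p - u)`, which is negative.
  · have hpX := h.X_neg hm3 hP hw hX
    refine (h.reach_right hk hm hP hS hw hsee hIH hX fun z hzu hz => ?_).mono ?_
    · obtain ⟨a, b, ha, hb, e⟩ := hq.exists_combination hzu hz
      have e' := congrArg F.X e
      rw [F.X_add, F.X_smul, F.X_smul] at e'
      have h3 : F.X ((z : Plane) - p) = F.X ((z : Plane) - u) - F.X ((p : Plane) - u) := by
        simp only [F.X_sub]; ring
      nlinarith [mul_nonneg ha (neg_nonneg.mpr hx.le), mul_nonneg hb (neg_nonneg.mpr hpX.le)]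
    · simp only [Frame.borderLength, F.X_flip, F.Y_flip, F.X_sub, F.Y_sub] at hpX ⊢
      linarith

end Chain

/-! ### The induction and the angle of the theorem -/

section Main

variable {F : Frame m} {u v w : P}

theorem reach_of_left (hk : 1 ≤ k) (hm : m = 4 * k + 2) (hP : GeneralPosition m P)
    (hS : PlanarConstraints S) (hw : F.InCone ((w : Plane) - u)) (hsee : CanSee S u w)
    (hIH : BoundsBelow S m (F.Y ((w : Plane) - u))) (hv : AddsEdge S m u v)
    (hvc : F.InCone ((v : Plane) - u)) (h : ChainState S F u w v) : PairBound S F u w := by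
  have huv := hv.reach.mono (norm_le_borderLength (by omega) F hvc)
  have hleft : 0 ≤ F.X ((w : Plane) - u) ∨ RightEmpty F u w →
      Reach S m u w (F.borderLength ((w : Plane) - u)) := fun hX => by
    refine (huv.trans (h.reach_left hk hm hP hS hw hsee hIH hX)).mono (le_of_eq ?_)
    simp only [Frame.borderLength_sub]; ring
  refine ⟨?_, fun hR => hleft (Or.inr hR)⟩
  rcases le_or_gt 0 (F.X ((w : Plane) - u)) with hX | hX
  · refine (hleft (Or.inl hX)).mono (le_of_eq ?_)
    rw [abs_of_nonneg hX, Frame.borderLength]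
  · refine (huv.trans (h.reach_mixed hk hm hP hS hw hsee hIH hX)).mono (le_of_eq ?_)
    rw [add_sub_cancel, abs_of_neg hX, Frame.borderLength, F.X_flip, F.Y_flip]

theorem pairBound_of_boundsBelow (hk : 1 ≤ k) (hm : m = 4 * k + 2) (hP : GeneralPosition m P)
    (hS : PlanarConstraints S) (huw : u ≠ w) (hw : F.InCone ((w : Plane) - u))
    (hsee : CanSee S u w) (hIH : BoundsBelow S m (F.Y ((w : Plane) - u))) : PairBound S F u w := by
  have hm3 : 3 ≤ m := by omega
  obtain ⟨v, hv, hvc, hvY, hfree, hlow⟩ := exists_addsEdge hm3 hP huw hsee hw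
  by_cases hvw : v = w
  · subst hvw
    have h1 := hv.reach.mono (norm_le_borderLength hm3 F hvc)
    refine ⟨h1.mono ?_, fun _ => h1⟩
    rw [Frame.borderLength]
    linarith [le_abs_self (F.X ((v : Plane) - u))]
  have state : ∀ G : Frame m, G.InCone ((v : Plane) - u) → (∀ d, G.Y d = F.Y d) →
      0 < turn G.σ ((w : Plane) - u) (v - u) → ChainState S G u w v := fun G hG hGY hpos =>
    ⟨hpos, hv.2.1, hG, hfree _ hpos, by simpa only [hGY] using hlow _ hpos⟩
  rcases lt_or_gt_of_ne (hP.turn_ne_zero F.sigma_ne_zero huw hv.1 (Ne.symm hvw)) with hD | hD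
  · have hflip : ∀ x y : Plane, turn F.flip.σ x y = - turn F.σ x y := fun x y => by
      simp only [turn, Frame.flip, Int.cast_neg]; ring
    have hst := state F.flip ((F.inCone_flip _).mpr hvc) (fun d => F.Y_flip d)
      (by rw [hflip]; linarith)
    have h1 := (reach_of_left hk hm hP hS ((F.inCone_flip _).mpr hw) hsee hIH hv
      ((F.inCone_flip _).mpr hvc) hst).1
    rw [F.X_flip, F.Y_flip, abs_neg] at h1
    -- With `v` to the right of `uw`, the right part is not empty: `v` lies in it.
    refine ⟨h1, fun hR => absurd ⟨?_, ?_, hvY⟩ (hR v)⟩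
    · rw [turn_swap]; linarith
    · exact (mul_le_mul_of_nonneg_right (le_abs_self _) (cos_aperture_half_pos hm3).le).trans hvc
  · exact reach_of_left hk hm hP hS hw hsee hIH hv hvc (state F hvc (fun _ => rfl) hD)

theorem pairBound (hk : 1 ≤ k) (hm : m = 4 * k + 2) (hP : GeneralPosition m P)
    (hS : PlanarConstraints S) (huw : u ≠ w) (hw : F.InCone ((w : Plane) - u))
    (hsee : CanSee S u w) : PairBound S F u w := by
  -- There are infinitely many frames but only `m` bisectors, so the heights form a finite set and
  -- `<` is well-founded on it.
  have hfin : {h : ℝ | ∃ (G : Frame m) (p q : P), h = G.Y ((q : Plane) - p)}.Finite := by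
    refine (Set.finite_range fun x : Fin m × P × P =>
      ⟪(x.2.2 : Plane) - x.2.1, bisectorDir m x.1⟫).subset ?_
    rintro _ ⟨G, p, q, rfl⟩
    obtain ⟨i, hi, hc, hs⟩ := G.exists_index (by omega)
    exact ⟨(⟨i, hi⟩, p, q), G.inner_eq_Y hc hs _⟩
  have hwf := hfin.wellFoundedOn (r := (· < ·))
  have main : ∀ h ∈ {h : ℝ | ∃ (G : Frame m) (p q : P), h = G.Y ((q : Plane) - p)},
      ∀ (G : Frame m) (p q : P), h = G.Y ((q : Plane) - p) → p ≠ q →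
        G.InCone ((q : Plane) - p) → CanSee S p q → PairBound S G p q := by
    intro h hh
    refine hwf.induction (P := fun h => ∀ (G : Frame m) (p q : P), h = G.Y ((q : Plane) - p) →
      p ≠ q → G.InCone ((q : Plane) - p) → CanSee S p q → PairBound S G p q) hh fun h _ ih => ?_
    rintro G p q rfl hpq hcone hsee
    refine pairBound_of_boundsBelow hk hm hP hS hpq hcone hsee fun G' p' q' h1 h2 h3 h4 => ?_
    exact ih _ ⟨G', p', q', rfl⟩ h4 G' p' q' rfl h1 h3 h2
  exact main _ ⟨F, u, w, rfl⟩ F u w rfl huw hw hsee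

theorem Frame.inner_eq (F : Frame m) (x y : Plane) :
    ⟪x, y⟫ = F.X x * F.X y + F.Y x * F.Y y := by
  have h := Real.sin_sq_add_cos_sq (F.j * aperture m)
  have hs := F.sigma_sq
  have e : ⟪x, y⟫ = x 0 * y 0 + x 1 * y 1 := by
    rw [PiLp.inner_apply, Fin.sum_univ_two]
    simp [mul_comm]
  rw [e]
  simp only [Frame.X, Frame.Y]
  linear_combination (-(x 0 * y 0 + x 1 * y 1)) * h -
    (x 0 * Real.cos (F.j * aperture m) - x 1 * Real.sin (F.j * aperture m)) *
      (y 0 * Real.cos (F.j * aperture m) - y 1 * Real.sin (F.j * aperture m)) * hs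

theorem Frame.canonicalMidpoint_coord (F : Frame m) (hm : 3 ≤ m) {i : ℕ}
    (hc : Real.cos (F.j * aperture m) = Real.cos (i * aperture m))
    (hs : Real.sin (F.j * aperture m) = Real.sin (i * aperture m)) (u w : Plane) :
    F.X (canonicalMidpoint m i u w - u) = 0 ∧
      F.Y (canonicalMidpoint m i u w - u) = F.Y (w - u) := by
  obtain ⟨h1, h2, h3, h4⟩ := F.X_rayDir hc hs
  have hcos := cos_aperture_half_pos hm
  have e : canonicalMidpoint m i u w - u =
      (F.Y (w - u) / (2 * Real.cos (aperture m / 2))) • (rayDir m i + rayDir m (i + 1)) := by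
    rw [canonicalMidpoint, corner, corner, F.inner_eq_Y hc hs, F.inner_eq_Y hc hs,
      F.inner_eq_Y hc hs, h2, h4, midpoint_eq_smul_add, invOf_eq_inv, mul_comm (2 : ℝ), ← div_div]
    module
  rw [e, F.X_smul, F.Y_smul, F.X_add, F.Y_add, h1, h2, h3, h4]
  constructor
  · ring
  · field_simp
    norm_num

/-- The segment to the midpoint is the altitude of the canonical triangle, so `α` is the angle to
the bisector and the bound in coordinates becomes the one of the theorem. -/
theorem Frame.cos_sin_angle (F : Frame m) {d v : Plane} (hX : F.X v = 0) (hY : F.Y v = F.Y d)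
    (hpos : 0 < F.Y d) :
    Real.cos (InnerProductGeometry.angle d v) * ‖d‖ = F.Y d ∧
      Real.sin (InnerProductGeometry.angle d v) * ‖d‖ = |F.X d| := by
  have hv : ‖v‖ = F.Y d := by
    rw [← Real.sqrt_sq (norm_nonneg v), F.norm_sq, hX, hY, zero_pow two_ne_zero, zero_add,
      Real.sqrt_sq hpos.le]
  have h1 : Real.cos (InnerProductGeometry.angle d v) * ‖d‖ = F.Y d := by
    have h := InnerProductGeometry.cos_angle_mul_norm_mul_norm d v
    rw [hv, F.inner_eq, hX, hY, mul_zero, zero_add, ← mul_assoc] at h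
    exact mul_right_cancel₀ hpos.ne' h
  refine ⟨h1, ?_⟩
  have h2 := Real.sin_sq_add_cos_sq (InnerProductGeometry.angle d v)
  have h3 := InnerProductGeometry.sin_angle_nonneg d v
  rw [← abs_of_nonneg (mul_nonneg h3 (norm_nonneg d)), ← sq_eq_sq_iff_abs_eq_abs]
  have h4 := F.norm_sq d
  have h5 : (Real.cos (InnerProductGeometry.angle d v) * ‖d‖) ^ 2 = F.Y d ^ 2 := by rw [h1]
  linear_combination ‖d‖ ^ 2 * h2 + h4 - h5

end Main

end ConstrainedTheta

end

theorem mainTheorem2 (k : ℕ) (hk : 1 ≤ k) (m : ℕ) (hm : m = 4 * k + 2)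
    (P : Finset ConstrainedTheta.Plane) (hP : ConstrainedTheta.GeneralPosition m P)
    (S : SimpleGraph P) (hS : ConstrainedTheta.PlanarConstraints S)
    (u w : P) (huw : u ≠ w) (hsee : ConstrainedTheta.CanSee S u w)
    (i : ℕ) (hi : i < m) (hw : (w : ConstrainedTheta.Plane) ∈ ConstrainedTheta.cone m i u)
    (θ α : ℝ) (hθ : θ = ConstrainedTheta.aperture m)
    (hα : α = EuclideanGeometry.angle (w : ConstrainedTheta.Plane) u
      (ConstrainedTheta.canonicalMidpoint m i u w)) :
    ∃ p : (ConstrainedTheta.constrainedThetaGraph S m).Walk u w, p.IsPath ∧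
      ConstrainedTheta.walkLength p ≤
        ((1 + Real.sin (θ / 2)) / Real.cos (θ / 2) * Real.cos α + Real.sin α) *
          dist (u : ConstrainedTheta.Plane) w := by
  classical
  have hm3 : 3 ≤ m := by omega
  set F : ConstrainedTheta.Frame m := ⟨i, 1, Or.inl rfl⟩
  have hc : Real.cos (F.j * ConstrainedTheta.aperture m) =
      Real.cos (i * ConstrainedTheta.aperture m) := by simp [F]
  have hs : Real.sin (F.j * ConstrainedTheta.aperture m) =
      Real.sin (i * ConstrainedTheta.aperture m) := by simp [F]
  have hin := (F.mem_cone_iff hm3 hc hs).mp hw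
  obtain ⟨W, hW⟩ := (ConstrainedTheta.pairBound hk hm hP hS huw hin hsee).1
  -- Removing cycles makes the walk a path without lengthening it.
  refine ⟨W.bypass, W.bypass_isPath,
    (ConstrainedTheta.walkLength_bypass_le W).trans (hW.trans (le_of_eq ?_))⟩
  obtain ⟨h1, h2⟩ := F.canonicalMidpoint_coord hm3 hc hs (u : ConstrainedTheta.Plane) w
  obtain ⟨h3, h4⟩ := F.cos_sin_angle h1 h2 (hin.Y_pos hm3 hP huw)
  rw [hα, hθ, EuclideanGeometry.angle, vsub_eq_sub, vsub_eq_sub, dist_comm, dist_eq_norm, add_mul,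
    h4, mul_assoc, h3, add_comm]
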